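/- **Graphs.** Fix an alphabet $\mathbb A$ of edge labels $\mathsf r$ with arities. A c-graph of type $n$ is a finite hypergraph $G$ with vertices and edges from fixed countably infinite sets, where every edge has a label and is attached to a sequence of vertices whose length is the arity of the label, together with a sequence of $n$ pairwise distinct vertices, its sources; the other vertices are internal. $G$ is simple if no two edges have the same label and the same attached vertices. **Formulas.** Quantifier- and predicate-free (qpf) formulas are built from $\mathsf{emp}$, $x=y$, $x\neq y$ and relation atoms $\mathsf r(x_1,\dots,x_k)$ by the separating conjunction $*$. For a simple c-graph $G$ of type $0$ and a store $\mathfrak s$ (a map from variables to the vertex universe): $G\models^{\mathfrak s}\mathsf{emp}$ iff $G$ is empty; $G\models^{\mathfrak s}x=y$ (resp. $x\ne y$) iff $G$ is empty and $\mathfrak s(x)=\mathfrak s(y)$ (resp. $\mathfrak s(x)\neq\mathfrak s(y)$); $G\models^{\mathfrak s}\mathsf r(x_1,\dots,x_k)$ iff $G$ consists of a single $\mathsf r$-labelled edge attached to $\mathfrak s(x_1),\dots,\mathfrak s(x_k)$ and of these vertices; $G\models^{\mathfrak s}\phi_1*\phi_2$ iff $G$ is the union of two subgraphs without common edges, with $G_i\models^{\mathfrak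 s}\phi_i$. The store $\mathfrak s$ is canonical for $\phi$ if, for all free variables $x,y$ of $\phi$, $\mathfrak s(x)=\mathfrak s(y)$ only if $x=y$ is a logical consequence of $\phi$. **SIDs.** A SID $\Delta$ is a finite set of rules $\mathsf B_0(x_1,\dots,x_n)\leftarrow\exists y_1\dots\exists y_m.\ \psi*\mathsf B_1(\mathbf z_1)*\dots*\mathsf B_k(\mathbf z_k)$, with $\psi$ a qpf formula, $\mathsf B_0,\dots,\mathsf B_k$ predicates, $n$ the arity of $\mathsf B_0$, and all variables among the $x_i,y_j$. It is equality-free if there are no equalities in $\psi$ and no repeated variables inside a predicate atom $\mathsf B_\ell(\mathbf z_\ell)$. A rule is unproductive if $m=0$, $\psi=\mathsf{emp}$ and $\mathbf z_\ell=(x_1,\dots,x_n)$ for all $\ell$. The SID $\Delta$ is regular if there is a set $\mathbb Q$ of predicates such that each rule is (A) $\mathsf B(\mathbf x)\leftarrow\mathsf B(\mathbf x)*\mathsf C(\mathbf x)$ with $\mathsf B\notin\mathbb Q$, $\mathsf C\in\mathbb Q$; or (B) $\mathsf B(\mathbf x)\leftarrow\mathsf C_1(\mathbf x)*\dots*\mathsf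 C_k(\mathbf x)$ with $k\ge1$, $\mathsf B\notin\mathbb Q$, $\mathsf C_1,\dots,\mathsf C_k\in\mathbb Q$; or (C) a rule with $\mathsf B_0\in\mathbb Q$ such that (1) either $m=k=0$ and $\psi$ has exactly one relation atom, in which all of $x_1,\dots,x_n$ occur, or there is at least one relation or predicate atom and each of them contains some $y_j$; and (2) any two distinct variables of the rule are linked by a path, in which consecutive variables occur together in a relation atom of $\psi$, and whose intermediate variables are all among $y_1,\dots,y_m$. **Grammars.** A hyperedge-replacement (HR) graph grammar $\Gamma=(\mathcal U,\mathcal R)$ has a finite set $\mathcal U$ of nonterminals with arities and a finite set $\mathcal R$ of rules $u\to u_1\parallel_n\dots\parallel_n u_k$ (unproductive; all these nonterminals have arity $n$) or $u\to(G,e_1,\dots,e_k)$, where $G$ is a c-graph with labels in $\mathbb A\cup\mathcal U$ whose type is the arity of $u$, and $e_1,\dots,e_k$ are its $\mathcal U$-labelled edges, each attached to pairwise distinct vertices. The operation $(G,e_1,\dots,e_k)$ replaces each $e_i$ by a graph whose sources are glued to the vertices attached to $e_i$, and $\parallel_n$ takes a disjoint union and glues the $i$-th sources, for all $i$. $\Gamma$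 is regular if there is $W\subseteq\mathcal U$ such that each rule is $u\to u\parallel_n w$ with $u\notin W$, $w\in W$; or $u\to w_1\parallel_n\dots\parallel_n w_k$ with $k\geq1$, $u\notin W$, $w_1,\dots,w_k\in W$; or $w\to(G,e_1,\dots,e_k)$ with $w\in W$ such that (1) either $G$ consists of its sources and of a single edge, labelled in $\mathbb A$ and attached to all of them, or $G$ has an edge and each of its edges is attached to an internal vertex; and (2) any two distinct vertices of $G$ are linked by a path of $\mathbb A$-labelled edges whose intermediate vertices are all internal. **Parse trees.** For $\Delta$ and a predicate $\mathsf A$ (resp. $\Gamma$ and a nonterminal $w$), a derivation tree is a finite tree with edges labelled by rules, an edge labelled by a rule with $k$ predicate atoms (nonterminals) on the right being attached to a parent and to $k$ ordered children that start with these predicates (nonterminals); the root starts with $\mathsf A$ (resp. $w$). A parse tree is a tree obtained, up to isomorphism, from a derivation tree by removing all edges labelled by unproductive rules and merging the vertices attached to each of them. The characteristic formula of a $(\Delta,\mathsf A)$-parse tree $T$, with $\mathsf A$ nullary, is the separating conjunction, over all edges of $T$, of the formulas $\psi$ of their rules, where the $y_j$ are renamed to fresh copies for each edge and the parameters $x_i$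 are replaced by the actual arguments. $\Delta$ is all-satisfiable for $\mathsf A$ if the characteristic formula of each $(\Delta,\mathsf A)$-parse tree is satisfiable. The value of a $\Gamma$-parse tree is the parallel composition, over the edges attached to the root, of the graph operation of their rule applied to the values of the subtrees; the language of $w$ in $\Gamma$ is the set of c-graphs isomorphic to values of $(\Gamma,w)$-parse trees. **Canonical models.** Let $\mathfrak d$ be an additional binary label. A rich canonical $\Delta$-model of a nullary predicate $\mathsf A$ is a c-graph $G$ with labels in $\mathbb A\cup\{\mathfrak d\}$ for which there are a $(\Delta,\mathsf A)$-parse tree $T$ with characteristic formula $\phi$ and a store $\mathfrak s$ canonical for $\phi$, such that the graph $G'$ obtained from $G$ by deleting its $\mathfrak d$-labelled edges satisfies $G'\models^{\mathfrak s}\phi$, and, for all vertices $u,v$, there is a $\mathfrak d$-labelled edge attached to $(u,v)$ iff some $x\neq y$ with $\mathfrak s(x)=u$ and $\mathfrak s(y)=v$ occurs in $\phi$. The graphs $G'$ so obtained are the canonical $\Delta$-models of $\mathsf A$. **Lemma.** Let $\mathsf A$ be a nullary predicate and let $\Delta$ be an equality-free regular SID that is all-satisfiable for $\mathsf A$. Then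 there are a regular HR graph grammar $\Gamma=(\mathcal U,\mathcal R)$, a nonterminal $w\in\mathcal U$ of arity $0$ and a bijection $\gamma:\Delta\to\mathcal R$ such that, for each tree $T$ with edges labelled by rules of $\Delta$, $T$ is a $(\Delta,\mathsf A)$-parse tree iff $\gamma(T)$ is a $(\Gamma,w)$-parse tree, where $\gamma(T)$ is obtained from $T$ by changing every edge label $\rho$ into $\gamma(\rho)$. Moreover, the set of canonical $\Delta$-models of $\mathsf A$ equals the language of $w$ in $\Gamma$. -/

import Mathlib

universe u v

/-! ## Concrete graphs -/

/-- A labelled hyperedge: its identity, its label and its sequence of attached vertices. -/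
structure HEdge (Λ : Type u) where
  id : ℕ
  lab : Λ
  att : List ℕ

/-- Finite concrete hypergraphs (c-graphs) with edge labels in the ranked alphabet `(Λ, ar)`.
Vertices and edge identities are drawn from countably infinite sets. The edge set together with the
label and attachment maps is given by the finite set of triples `(id, label, attached vertices)`, in
which every identity occurs once. The list `src` enumerates the (pairwise distinct) sources, and its
length is the type of the graph. -/
structure CGraph {Λ : Type u} (ar : Λ → ℕ) where
  verts : Set ℕ
  edges : Set (HEdge Λ)
  src : List ℕ
  verts_finite : verts.Finite
  edges_finite : edges.Finite
  id_inj : ∀ e ∈ edges, ∀ e' ∈ edges, e.id = e'.id → e = e'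
  att_length : ∀ e ∈ edges, e.att.length = ar e.lab
  att_mem : ∀ e ∈ edges, ∀ x ∈ e.att, x ∈ verts
  src_mem : ∀ x ∈ src, x ∈ verts
  src_nodup : src.Nodup

namespace CGraph

variable {Λ : Type u} {ar : Λ → ℕ}

/-- The identities of the edges. -/
def ids (G : CGraph ar) : Set ℕ := HEdge.id '' G.edges

/-- No two distinct edges have the same label and the same attached vertices. -/
def Simple (G : CGraph ar) : Prop :=
  ∀ e ∈ G.edges, ∀ e' ∈ G.edges, e.lab = e'.lab → e.att = e'.att → e = e'

/-- Isomorphism of c-graphs: `f` renames the vertices and `g` the edges. -/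
def Iso (G H : CGraph ar) : Prop :=
  ∃ f g : ℕ → ℕ, Set.InjOn f G.verts ∧ Set.InjOn g G.ids ∧
    H.verts = f '' G.verts ∧
    H.edges = (fun e : HEdge Λ => ⟨g e.id, e.lab, e.att.map f⟩) '' G.edges ∧
    H.src = G.src.map f

/-- `K` is a parallel composition of `G` and `H`: the union of isomorphic copies of `G` and `H` that
have the same sources, share no other vertices, and share no edges. -/
def IsPar (G H K : CGraph ar) : Prop :=
  ∃ G' H' : CGraph ar, G.Iso G' ∧ H.Iso H' ∧
    G'.src = H'.src ∧
    G'.verts ∩ H'.verts = {x | x ∈ G'.src} ∧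
    Disjoint G'.ids H'.ids ∧
    K.verts = G'.verts ∪ H'.verts ∧
    K.edges = G'.edges ∪ H'.edges ∧
    K.src = G'.src

/-- The graph consists only of its sources. -/
def IsDiscrete (G : CGraph ar) : Prop :=
  G.verts = {x | x ∈ G.src} ∧ G.edges = ∅

end CGraph

/-! ## Quantifier- and predicate-free formulas -/

/-- Equalities, disequalities and relation atoms over the variables `V`. -/
inductive Atom {L : Type u} (ar : L → ℕ) (V : Type v) : Type (max u v)
  | eq (x y : V)
  | neq (x y : V)
  | rel (r : L) (xs : Fin (ar r) → V)

/-- Quantifier- and predicate-free (qpf) formulas: `emp`, atoms, separating conjunction. -/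
inductive QFormula {L : Type u} (ar : L → ℕ) (V : Type v) : Type (max u v)
  | emp
  | atom (a : Atom ar V)
  | star (φ ψ : QFormula ar V)

namespace Atom

variable {L : Type u} {ar : L → ℕ} {V W : Type*}

def subst (σ : V → W) : Atom ar V → Atom ar W
  | eq x y => eq (σ x) (σ y)
  | neq x y => neq (σ x) (σ y)
  | rel r xs => rel r (fun i => σ (xs i))

def vars : Atom ar V → Set V
  | eq x y => {x, y}
  | neq x y => {x, y}
  | rel _ xs => Set.range xs

def isRel : Atom ar V → Bool
  | eq _ _ => false
  | neq _ _ => false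
  | rel _ _ => true

/-- Satisfaction of an atom by a type-`0` graph, under a store `s`. -/
def Sat (G : CGraph ar) (s : V → ℕ) : Atom ar V → Prop
  | eq x y => G.verts = ∅ ∧ G.edges = ∅ ∧ s x = s y
  | neq x y => G.verts = ∅ ∧ G.edges = ∅ ∧ s x ≠ s y
  | rel r xs => G.verts = Set.range (fun i => s (xs i)) ∧
      ∃ k : ℕ, G.edges = {⟨k, r, List.ofFn (fun i => s (xs i))⟩}

end Atom

namespace QFormula

variable {L : Type u} {ar : L → ℕ} {V W : Type*}

/-- The occurrences of atoms in a formula. -/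
def atoms : QFormula ar V → List (Atom ar V)
  | emp => []
  | atom a => [a]
  | star φ ψ => φ.atoms ++ ψ.atoms

def subst (σ : V → W) : QFormula ar V → QFormula ar W
  | emp => emp
  | atom a => atom (a.subst σ)
  | star φ ψ => star (φ.subst σ) (ψ.subst σ)

/-- Free variables. -/
def fv (φ : QFormula ar V) : Set V := {x | ∃ a ∈ φ.atoms, x ∈ a.vars}

/-- Iterated separating conjunction. -/
def bigStar (l : List (QFormula ar V)) : QFormula ar V := l.foldr star emp

/-- Satisfaction. A separating conjunction splits the graph into two subgraphs
with no common edge. -/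
def Sat (s : V → ℕ) : QFormula ar V → CGraph ar → Prop
  | emp, G => G.verts = ∅ ∧ G.edges = ∅
  | atom a, G => a.Sat G s
  | star φ ψ, G => ∃ G₁ G₂ : CGraph ar, G₁.src = [] ∧ G₂.src = [] ∧
      Disjoint G₁.ids G₂.ids ∧
      G.verts = G₁.verts ∪ G₂.verts ∧ G.edges = G₁.edges ∪ G₂.edges ∧
      φ.Sat s G₁ ∧ ψ.Sat s G₂

/-- `G ⊨ˢ φ`: models are simple c-graphs of type `0`. -/
def Models (G : CGraph ar) (s : V → ℕ) (φ : QFormula ar V) : Prop :=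
  G.src = [] ∧ G.Simple ∧ φ.Sat s G

def Satisfiable (φ : QFormula ar V) : Prop :=
  ∃ (G : CGraph ar) (s : V → ℕ), Models G s φ

/-- The equality `x = y` is a logical consequence of `φ`. -/
def EntailsEq (φ : QFormula ar V) (x y : V) : Prop :=
  ∀ (G : CGraph ar) (s : V → ℕ), Models G s φ → s x = s y

/-- The store `s` is canonical for `φ`. -/
def Canonical (s : V → ℕ) (φ : QFormula ar V) : Prop :=
  ∀ x ∈ φ.fv, ∀ y ∈ φ.fv, s x = s y → φ.EntailsEq x y

end QFormula

/-! ## Derivation trees and parse trees -/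

/-- Ordered trees labelled by rules. -/
inductive DTree (R : Type u) : Type u
  | node (ρ : R) (k : ℕ) (sub : Fin k → DTree R)

/-- Finite rooted trees whose (hyper)edges are labelled by `R`. `leaf` is a single vertex;
`edge ρ k sub rest` is obtained from `rest` by attaching to its root one more edge, labelled by `ρ`,
whose first attached vertex is that root and whose remaining `k` attached vertices are the roots of
the trees `sub 0, …, sub (k - 1)`. -/
inductive PTree (R : Type u) : Type u
  | leaf
  | edge (ρ : R) (k : ℕ) (sub : Fin k → PTree R) (rest : PTree R)

namespace PTree

variable {R S : Type*}

/-- Relabelling of the edges. -/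
def map (f : R → S) : PTree R → PTree S
  | leaf => leaf
  | edge ρ k sub rest => edge (f ρ) k (fun i => (sub i).map f) (rest.map f)

/-- Joining two trees at their roots. -/
def join : PTree R → PTree R → PTree R
  | leaf, t => t
  | edge ρ k sub rest, t => edge ρ k sub (rest.join t)

/-- Isomorphism of trees: the edges below a vertex are not ordered. -/
inductive Iso : PTree R → PTree R → Prop
  | leaf : Iso leaf leaf
  | edge (ρ : R) (k : ℕ) (sub sub' : Fin k → PTree R) (rest rest' : PTree R) :
      (∀ i, Iso (sub i) (sub' i)) → Iso rest rest' →
      Iso (edge ρ k sub rest) (edge ρ k sub' rest')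
  | swap (ρ : R) (k : ℕ) (sub : Fin k → PTree R) (ρ' : R) (k' : ℕ) (sub' : Fin k' → PTree R)
      (rest : PTree R) :
      Iso (edge ρ k sub (edge ρ' k' sub' rest)) (edge ρ' k' sub' (edge ρ k sub rest))
  | trans (t₁ t₂ t₃ : PTree R) : Iso t₁ t₂ → Iso t₂ t₃ → Iso t₁ t₃

end PTree

namespace DTree

variable {R N : Type*}

/-- `U.Derives lhs rhs a`: the tree `U` is a derivation tree starting with the nonterminal `a`, where
`lhs ρ` is the left-hand side of the rule `ρ` and `rhs ρ` the sequence of nonterminals of its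
right-hand side. -/
def Derives (lhs : R → N) (rhs : R → List N) : DTree R → N → Prop
  | node ρ k sub, a => lhs ρ = a ∧
      ∃ h : (rhs ρ).length = k, ∀ i : Fin k,
        (sub i).Derives lhs rhs ((rhs ρ).get (i.cast h.symm))

open Classical in
/-- Removal of all edges labelled by unproductive rules: the vertices attached to such an edge are
merged. -/
noncomputable def contract (unprod : R → Prop) : DTree R → PTree R
  | node ρ k sub =>
      if unprod ρ then
        (List.ofFn (fun i => (sub i).contract unprod)).foldr PTree.join PTree.leaf
      else
        PTree.edge ρ k (fun i => (sub i).contract unprod) PTree.leaf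

end DTree

/-- The parse trees of a system of rules: the trees obtained from derivation trees by removing the
edges labelled by unproductive rules, up to isomorphism. -/
def parseTrees {R N : Type*} (lhs : R → N) (rhs : R → List N) (unprod : R → Prop) (a : N) :
    Set (PTree R) :=
  {T | ∃ U : DTree R, U.Derives lhs rhs a ∧ (U.contract unprod).Iso T}

/-- `a` and `b` are linked by a path of `adj`-steps whose intermediate points are all internal. -/
inductive InternalPath {V : Type*} (adj : V → V → Prop) (internal : V → Prop) : V → V → Prop
  | single (a b : V) : adj a b → InternalPath adj internal a b
  | cons (a c b : V) : adj a c → internal c → InternalPath adj internal c b →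
      InternalPath adj internal a b

/-! ## Sets of inductive definitions -/

/-- A predicate atom `B(z₁, …, z_{#B})`. -/
structure PredAtom {P : Type u} (arP : P → ℕ) (V : Type v) where
  pred : P
  args : Fin (arP pred) → V

/-- A rule `B₀(x₁, …, xₙ) ← ∃ y₁ … ∃ yₘ . ψ * B₁(z₁) * … * Bₖ(zₖ)`, with `n = #B₀`. The variable
`xᵢ` is `Sum.inl i` and `yⱼ` is `Sum.inr j`. -/
structure SIDRule {L : Type u} (ar : L → ℕ) {P : Type v} (arP : P → ℕ) where
  head : P
  m : ℕ
  psi : QFormula ar (Fin (arP head) ⊕ Fin m)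
  calls : List (PredAtom arP (Fin (arP head) ⊕ Fin m))

namespace SIDRule

variable {L : Type u} {ar : L → ℕ} {P : Type v} {arP : P → ℕ}

/-- The predicate atom is `B(x₁, …, xₙ)`, where `x₁, …, xₙ` are exactly the parameters of the rule. -/
def PassesParams (ρ : SIDRule ar arP) (c : PredAtom arP (Fin (arP ρ.head) ⊕ Fin ρ.m)) : Prop :=
  List.ofFn c.args = List.ofFn (fun i : Fin (arP ρ.head) => Sum.inl i)

/-- The rule is `B₀(x₁, …, xₙ) ← B₁(x₁, …, xₙ) * … * Bₖ(x₁, …, xₙ)`. -/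
def Unproductive (ρ : SIDRule ar arP) : Prop :=
  ρ.m = 0 ∧ ρ.psi = QFormula.emp ∧ ∀ c ∈ ρ.calls, ρ.PassesParams c

/-- Two variables occur in the same relation atom. -/
def Adj (ρ : SIDRule ar arP) (z z' : Fin (arP ρ.head) ⊕ Fin ρ.m) : Prop :=
  ∃ a ∈ ρ.psi.atoms, a.isRel = true ∧ z ∈ a.vars ∧ z' ∈ a.vars

/-- The condition on the body of a productive rule of a regular SID. -/
def RegularBody (ρ : SIDRule ar arP) : Prop :=
  ((ρ.m = 0 ∧ ρ.calls = [] ∧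
      ∃ a, ρ.psi.atoms.filter Atom.isRel = [a] ∧ ∀ z, z ∈ a.vars) ∨
    (((∃ a ∈ ρ.psi.atoms, a.isRel = true) ∨ ρ.calls ≠ []) ∧
      (∀ a ∈ ρ.psi.atoms, a.isRel = true → ∃ j, Sum.inr j ∈ a.vars) ∧
      (∀ c ∈ ρ.calls, ∃ j, Sum.inr j ∈ Set.range c.args))) ∧
  ∀ z z', z ≠ z' → InternalPath ρ.Adj (fun t => t.isRight = true) z z'

/-- No equalities, and no predicate atom with two occurrences of a variable. -/
def EqualityFree (ρ : SIDRule ar arP) : Prop :=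
  (∀ x y, Atom.eq x y ∉ ρ.psi.atoms) ∧ ∀ c ∈ ρ.calls, Function.Injective c.args

end SIDRule

/-- A set of inductive definitions: a finite set of rules. -/
structure SID {L : Type u} (ar : L → ℕ) {P : Type v} (arP : P → ℕ) where
  rules : Set (SIDRule ar arP)
  finite : rules.Finite

/-- The variables of characteristic formulas: `(p, j)` is the copy of the existentially quantified
variable `yⱼ` introduced by the edge with address `p` of a parse tree. -/
abbrev TVar : Type := List ℕ × ℕ

/-- The alphabet extended by the binary label `none`, recording disequalities. -/
def arD {L : Type u} (ar : L → ℕ) : Option L → ℕ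
  | none => 2
  | some r => ar r

/-- Deletion of the edges with the label `none`. -/
def CGraph.proj {L : Type u} {ar : L → ℕ} (G : CGraph (arD ar)) : CGraph ar where
  verts := G.verts
  edges := {e | (⟨e.id, some e.lab, e.att⟩ : HEdge (Option L)) ∈ G.edges}
  src := G.src
  verts_finite := G.verts_finite
  edges_finite := by
    refine G.edges_finite.preimage
      (f := fun e : HEdge L => (⟨e.id, some e.lab, e.att⟩ : HEdge (Option L))) ?_
    rintro ⟨i, r, a⟩ - ⟨j, q, b⟩ - h
    simpa using h
  id_inj := by
    rintro ⟨i, r, a⟩ he ⟨j, q, b⟩ he' h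
    simpa using G.id_inj _ he _ he' h
  att_length := fun e he => G.att_length _ he
  att_mem := fun e he => G.att_mem _ he
  src_mem := G.src_mem
  src_nodup := G.src_nodup

namespace SID

variable {L : Type u} {ar : L → ℕ} {P : Type v} {arP : P → ℕ}

def EqualityFree (Δ : SID ar arP) : Prop := ∀ ρ ∈ Δ.rules, ρ.EqualityFree

/-- Regular SIDs; `Q` is the set of productive predicates. The rules are
`B(x) ← B(x) * C(x)` with `B ∉ Q` and `C ∈ Q`, or
`B(x) ← C₁(x) * … * Cₖ(x)` with `k ≥ 1`, `B ∉ Q` and `C₁, …, Cₖ ∈ Q`, or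
rules with a head in `Q` and a regular body. -/
def Regular (Δ : SID ar arP) : Prop :=
  ∃ Q : Set P, ∀ ρ ∈ Δ.rules,
    (ρ.head ∉ Q ∧ ρ.Unproductive ∧
      ∃ C ∈ Q, ρ.calls.map PredAtom.pred = [ρ.head, C]) ∨
    (ρ.head ∉ Q ∧ ρ.Unproductive ∧ ρ.calls ≠ [] ∧ ∀ c ∈ ρ.calls, c.pred ∈ Q) ∨
    (ρ.head ∈ Q ∧ ρ.RegularBody)

/-- The `(Δ, A)`-parse trees. -/
def parseTrees (Δ : SID ar arP) (A : P) : Set (PTree Δ.rules) :=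
  _root_.parseTrees (fun ρ : Δ.rules => ρ.1.head)
    (fun ρ : Δ.rules => ρ.1.calls.map PredAtom.pred) (fun ρ : Δ.rules => ρ.1.Unproductive) A

/-- The instantiation of the variables of a rule labelling the edge with address `p` below a vertex
with actual parameters `args`. -/
def inst {n m : ℕ} (args : List TVar) (p : List ℕ) : Fin n ⊕ Fin m → TVar
  | Sum.inl i => args.getD i ([], 0)
  | Sum.inr j => (p, j)

/-- The characteristic formula of a tree whose root has the actual parameters `args`. The list `p`
serves as an address that makes the copies of the existentially quantified variables fresh: distinct
edges have distinct addresses. -/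
def charFormAux {Δ : SID ar arP} : PTree Δ.rules → List TVar → List ℕ → QFormula ar TVar
  | PTree.leaf, _, _ => QFormula.emp
  | PTree.edge ρ k sub rest, args, p =>
      QFormula.star (ρ.1.psi.subst (inst args p))
        (QFormula.star
          (QFormula.bigStar (List.ofFn (fun i : Fin k =>
            charFormAux (sub i)
              (((ρ.1.calls[(i : ℕ)]?).map
                (fun c => List.ofFn (fun j => inst args p (c.args j)))).getD [])
              (((i : ℕ) + 1) :: p))))
          (charFormAux rest args (0 :: p)))

/-- The characteristic formula of a parse tree of a nullary predicate. -/
def charForm {Δ : SID ar arP} (T : PTree Δ.rules) : QFormula ar TVar := charFormAux T [] []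

def AllSatisfiable (Δ : SID ar arP) (A : P) : Prop :=
  ∀ T ∈ Δ.parseTrees A, (charForm T).Satisfiable

/-- Rich canonical `Δ`-models of a nullary predicate `A`. -/
def richCanonicalModels (Δ : SID ar arP) (A : P) : Set (CGraph (arD ar)) :=
  {G | ∃ T ∈ Δ.parseTrees A, ∃ s : TVar → ℕ,
    QFormula.Canonical s (charForm T) ∧
    QFormula.Models G.proj s (charForm T) ∧
    ∀ a ∈ G.verts, ∀ b ∈ G.verts,
      ((∃ e ∈ G.edges, e.lab = none ∧ e.att = [a, b]) ↔
        ∃ x y, s x = a ∧ s y = b ∧ Atom.neq x y ∈ (charForm T).atoms)}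

/-- Canonical `Δ`-models of a nullary predicate `A`. -/
def canonicalModels (Δ : SID ar arP) (A : P) : Set (CGraph ar) :=
  CGraph.proj '' Δ.richCanonicalModels A

end SID

/-! ## Hyperedge-replacement graph grammars -/

/-- Right-hand sides of grammar rules: `u₁ ∥ … ∥ uₖ`, or `(G, e₁, …, eₖ)` where `G` is a
c-graph with edges labelled by terminals (`Sum.inl`) or nonterminals (`Sum.inr`), and `e₁, …, eₖ` are
its nonterminal-labelled edges. -/
inductive HRRhs {L : Type u} (ar : L → ℕ) {N : Type v} (arN : N → ℕ) : Type (max u v)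
  | par (us : List N)
  | op (G : CGraph (Sum.elim ar arN)) (es : List (HEdge N))

namespace HRRhs

variable {L : Type u} {ar : L → ℕ} {N : Type v} {arN : N → ℕ}

/-- The sequence of nonterminals of a right-hand side. -/
def nonterms : HRRhs ar arN → List N
  | par us => us
  | op _ es => es.map HEdge.lab

def IsPar : HRRhs ar arN → Prop
  | par _ => True
  | op _ _ => False

/-- Well-formedness of a right-hand side of type `n`: all components of a parallel composition
have type `n`; in `(G, e₁, …, eₖ)`, the graph `G` has type `n` and `e₁, …, eₖ` enumerates
its nonterminal-labelled edges without repetition, each attached to pairwise distinct vertices. -/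
def WellFormed (n : ℕ) : HRRhs ar arN → Prop
  | par us => ∀ a ∈ us, arN a = n
  | op G es => G.src.length = n ∧ es.Nodup ∧ (∀ e ∈ es, e.att.Nodup) ∧
      ∀ e : HEdge N, e ∈ es ↔ (⟨e.id, Sum.inr e.lab, e.att⟩ : HEdge (L ⊕ N)) ∈ G.edges

/-- The terminal-labelled edges of a graph. -/
def termEdges (G : CGraph (Sum.elim ar arN)) : Set (HEdge L) :=
  {e | (⟨e.id, Sum.inl e.lab, e.att⟩ : HEdge (L ⊕ N)) ∈ G.edges}

/-- Regularity of a graph operation `(G, e₁, …, eₖ)`. Either `G` consists of its sources and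
of a single edge, which is terminal and attached to all of them, or `G` has an edge and
each of its edges is attached to some internal (non-source) vertex; moreover, any two vertices are
linked by a path of terminal edges that traverses only internal vertices, except for its ends. -/
def RegularOp (G : CGraph (Sum.elim ar arN)) : Prop :=
  ((∃ e : HEdge L, G.edges = {⟨e.id, Sum.inl e.lab, e.att⟩} ∧
      G.verts = {x | x ∈ G.src} ∧ ∀ x ∈ G.src, x ∈ e.att) ∨
    (G.edges.Nonempty ∧ ∀ e ∈ G.edges, ∃ x ∈ e.att, x ∉ G.src)) ∧
  ∀ x ∈ G.verts, ∀ y ∈ G.verts, x ≠ y →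
    InternalPath (fun a b => ∃ e ∈ termEdges G, a ∈ e.att ∧ b ∈ e.att) (fun a => a ∉ G.src) x y

/-- `K` is obtained from `G` by replacing each edge `es i` by an isomorphic copy of `H i`, whose
sequence of sources is the sequence of vertices attached to that edge; the copies are otherwise
disjoint from `G` and from each other. -/
def IsSubst (G : CGraph (Sum.elim ar arN)) (es : List (HEdge N)) {k : ℕ}
    (H : Fin k → CGraph ar) (K : CGraph ar) : Prop :=
  ∃ (h : es.length = k) (H' : Fin k → CGraph ar),
    (∀ i, (H i).Iso (H' i)) ∧
    (∀ i, (H' i).src = (es.get (i.cast h.symm)).att) ∧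
    (∀ i, (H' i).verts ∩ G.verts = {x | x ∈ (H' i).src}) ∧
    (∀ i j, i ≠ j → (H' i).verts ∩ (H' j).verts ⊆ G.verts) ∧
    (∀ i, Disjoint (H' i).ids (HEdge.id '' termEdges G)) ∧
    (∀ i j, i ≠ j → Disjoint (H' i).ids (H' j).ids) ∧
    K.verts = G.verts ∪ ⋃ i, (H' i).verts ∧
    K.edges = termEdges G ∪ ⋃ i, (H' i).edges ∧
    K.src = G.src

end HRRhs

/-- A hyperedge-replacement graph grammar: a finite set of nonterminals and a finite set of rules
`u → rhs`. -/
structure HRGrammar {L : Type u} (ar : L → ℕ) {N : Type v} (arN : N → ℕ) where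
  nonterms : Set N
  rules : Set (N × HRRhs ar arN)
  nonterms_finite : nonterms.Finite
  rules_finite : rules.Finite
  lhs_mem : ∀ ρ ∈ rules, ρ.1 ∈ nonterms
  rhs_mem : ∀ ρ ∈ rules, ∀ a ∈ ρ.2.nonterms, a ∈ nonterms
  wellFormed : ∀ ρ ∈ rules, ρ.2.WellFormed (arN ρ.1)

namespace HRGrammar

variable {L : Type u} {ar : L → ℕ} {N : Type v} {arN : N → ℕ}

/-- Regular graph grammars. The rules are `u → u ∥ w` with `u ∉ W` and `w ∈ W`, or
`u → w₁ ∥ … ∥ wₖ` with `k ≥ 1`, `u ∉ W` and `w₁, …, wₖ ∈ W`, or `w → (G, e₁, …, eₖ)`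
with `w ∈ W` and a regular graph operation. -/
def Regular (Γ : HRGrammar ar arN) : Prop :=
  ∃ W ⊆ Γ.nonterms, ∀ ρ ∈ Γ.rules,
    (ρ.1 ∉ W ∧ ∃ w ∈ W, ρ.2 = HRRhs.par [ρ.1, w]) ∨
    (ρ.1 ∉ W ∧ ∃ ws, ws ≠ [] ∧ (∀ w ∈ ws, w ∈ W) ∧ ρ.2 = HRRhs.par ws) ∨
    (ρ.1 ∈ W ∧ ∃ G es, ρ.2 = HRRhs.op G es ∧ HRRhs.RegularOp G)

/-- The `(Γ, w)`-parse trees. -/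
def parseTrees (Γ : HRGrammar ar arN) (w : N) : Set (PTree Γ.rules) :=
  _root_.parseTrees (fun ρ : Γ.rules => ρ.1.1)
    (fun ρ : Γ.rules => ρ.1.2.nonterms) (fun ρ : Γ.rules => ρ.1.2.IsPar) w

/-- `K` is (a c-graph in the isomorphism class of) the value of a parse tree: the parallel
composition, over the edges attached to the root, of the graph operation labelling the edge applied to
the values of the subtrees. -/
def IsVal {Γ : HRGrammar ar arN} : PTree Γ.rules → CGraph ar → Prop
  | PTree.leaf, K => K.IsDiscrete
  | PTree.edge ρ k sub rest, K =>
      ∃ (G : CGraph (Sum.elim ar arN)) (es : List (HEdge N)) (H : Fin k → CGraph ar)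
        (K₁ K₂ : CGraph ar),
        ρ.1.2 = HRRhs.op G es ∧ (∀ i, IsVal (sub i) (H i)) ∧ HRRhs.IsSubst G es H K₁ ∧
        IsVal rest K₂ ∧ CGraph.IsPar K₁ K₂ K

/-- The language of `w` in `Γ`. -/
def language (Γ : HRGrammar ar arN) (w : N) : Set (CGraph ar) :=
  {K | K.src.length = arN w ∧ ∃ T ∈ Γ.parseTrees w, IsVal T K}

end HRGrammar

/-! ## Gluing injective maps -/

/-- Compatible maps on the members of a family of sets have a common extension. -/
theorem exists_glue_injOn {ι X Y : Type*} [Nonempty Y] (V : ι → Set X) (f : ι → X → Y)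
    (h : ∀ i j, ∀ x ∈ V i, ∀ y ∈ V j, (f i x = f j y ↔ x = y)) :
    ∃ s : X → Y, (∀ i, Set.EqOn s (f i) (V i)) ∧ Set.InjOn s (⋃ i, V i) := by
  classical
  have key : ∀ i, Set.EqOn
      (fun x => if hx : ∃ i, x ∈ V i then f hx.choose x else Classical.arbitrary Y) (f i) (V i) := by
    intro i x hx
    have hx' : ∃ i, x ∈ V i := ⟨i, hx⟩
    simp only [dif_pos hx']
    exact (h _ _ _ hx'.choose_spec _ hx).2 rfl
  refine ⟨_, key, ?_⟩
  intro x hx y hy hxy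
  obtain ⟨i, hi⟩ := Set.mem_iUnion.1 hx
  obtain ⟨j, hj⟩ := Set.mem_iUnion.1 hy
  rw [key i hi, key j hj] at hxy
  exact (h _ _ _ hi _ hj).1 hxy

theorem exists_glue_injOn_union {X Y : Type*} [Nonempty Y] {V W : Set X} {f g : X → Y}
    (hf : Set.InjOn f V) (hg : Set.InjOn g W)
    (h : ∀ x ∈ V, ∀ y ∈ W, (f x = g y ↔ x = y)) :
    ∃ s : X → Y, Set.EqOn s f V ∧ Set.EqOn s g W ∧ Set.InjOn s (V ∪ W) := by
  obtain ⟨s, hs, hsi⟩ := exists_glue_injOn (fun b : Bool => cond b V W) (fun b => cond b f g) (by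
    rintro (_ | _) (_ | _) x hx y hy
    · exact hg.eq_iff hx hy
    · rw [eq_comm, @eq_comm _ x]; exact h y hy x hx
    · exact h x hx y hy
    · exact hf.eq_iff hx hy)
  rw [← Set.union_eq_iUnion] at hsi
  exact ⟨s, hs true, hs false, hsi⟩

/-! ## Abstract hypergraphs and their realizations -/

/-- A hyperedge whose identity and attached vertices are taken from `X`. -/
structure PreEdge (L : Type u) (X : Type v) where
  addr : X
  lab : L
  att : List X

/-- A hypergraph with sources whose vertices and edge identities are taken from `X`. -/
structure PreGraph (L : Type u) (X : Type v) where
  verts : Set X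
  edges : Set (PreEdge L X)
  src : List X

/-- The image of an edge under the renaming `s` of vertices and `g` of edge identities. -/
def PreEdge.real {L : Type u} {X : Type v} (s g : X → ℕ) (e : PreEdge L X) : HEdge L :=
  ⟨g e.addr, e.lab, e.att.map s⟩

/-- The identities of a set of edges. -/
def PreEdge.addrs {L : Type u} {X : Type v} (E : Set (PreEdge L X)) : Set X := PreEdge.addr '' E

namespace PreEdge

variable {L : Type u} {X : Type v}

theorem mem_addrs {E : Set (PreEdge L X)} {e : PreEdge L X} (h : e ∈ E) : e.addr ∈ addrs E :=
  ⟨e, h, rfl⟩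

theorem addrs_union (E F : Set (PreEdge L X)) : addrs (E ∪ F) = addrs E ∪ addrs F :=
  Set.image_union _ _ _

theorem addrs_iUnion {ι : Sort*} (E : ι → Set (PreEdge L X)) :
    addrs (⋃ i, E i) = ⋃ i, addrs (E i) :=
  Set.image_iUnion

theorem ids_real_image {s g : X → ℕ} (E : Set (PreEdge L X)) :
    HEdge.id '' (real s g '' E) = g '' addrs E := by
  simp only [addrs, Set.image_image, real]

theorem real_congr {s g s' g' : X → ℕ} {e : PreEdge L X} (hg : g e.addr = g' e.addr)
    (hs : ∀ x ∈ e.att, s x = s' x) : real s g e = real s' g' e := by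
  simp only [real, hg, List.map_congr_left hs]

theorem image_real_congr {s g s' g' : X → ℕ} {E : Set (PreEdge L X)} {V : Set X}
    (hE : ∀ e ∈ E, ∀ x ∈ e.att, x ∈ V) (hs : Set.EqOn s s' V) (hg : Set.EqOn g g' (addrs E)) :
    real s g '' E = real s' g' '' E :=
  Set.image_congr fun e he => real_congr (hg (mem_addrs he)) fun x hx => hs (hE e he x hx)

end PreEdge

namespace PreGraph

variable {L : Type u} {ar : L → ℕ} {X : Type v}

/-- The conditions under which injective renamings yield a c-graph. -/
structure WF (ar : L → ℕ) (D : PreGraph L X) : Prop where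
  verts_finite : D.verts.Finite
  edges_finite : D.edges.Finite
  addr_inj : Set.InjOn PreEdge.addr D.edges
  att_length : ∀ e ∈ D.edges, e.att.length = ar e.lab
  att_mem : ∀ e ∈ D.edges, ∀ x ∈ e.att, x ∈ D.verts
  src_mem : ∀ x ∈ D.src, x ∈ D.verts
  src_nodup : D.src.Nodup

/-- `K` is the image of `D` under the injective renamings `s` and `g`. -/
structure Realizes (D : PreGraph L X) (s g : X → ℕ) (K : CGraph ar) : Prop where
  s_inj : Set.InjOn s D.verts
  g_inj : Set.InjOn g (PreEdge.addrs D.edges)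
  verts : K.verts = s '' D.verts
  edges : K.edges = PreEdge.real s g '' D.edges
  src : K.src = D.src.map s

/-- `K` is a copy of `D`. -/
def IsCopy (D : PreGraph L X) (K : CGraph ar) : Prop := ∃ s g, D.Realizes s g K

theorem WF.exists_realizes {D : PreGraph L X} (hD : D.WF ar) {s g : X → ℕ}
    (hs : Set.InjOn s D.verts) (hg : Set.InjOn g (PreEdge.addrs D.edges)) :
    ∃ K : CGraph ar, D.Realizes s g K := by
  refine ⟨⟨s '' D.verts, PreEdge.real s g '' D.edges, D.src.map s, hD.verts_finite.image _,
    hD.edges_finite.image _, ?_, ?_, ?_, ?_, ?_⟩, hs, hg, rfl, rfl, rfl⟩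
  · rintro _ ⟨e, he, rfl⟩ _ ⟨e', he', rfl⟩ h
    rw [hD.addr_inj he he' (hg (PreEdge.mem_addrs he) (PreEdge.mem_addrs he') h)]
  · rintro _ ⟨e, he, rfl⟩
    simpa [PreEdge.real] using hD.att_length e he
  · rintro _ ⟨e, he, rfl⟩ x hx
    obtain ⟨y, hy, rfl⟩ := List.mem_map.1 hx
    exact ⟨y, hD.att_mem e he y hy, rfl⟩
  · intro x hx
    obtain ⟨y, hy, rfl⟩ := List.mem_map.1 hx
    exact ⟨y, hD.src_mem y hy, rfl⟩
  · exact hD.src_nodup.map_on fun x hx y hy h => hs (hD.src_mem x hx) (hD.src_mem y hy) h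

theorem Realizes.ids {D : PreGraph L X} {s g : X → ℕ} {K : CGraph ar} (h : D.Realizes s g K) :
    K.ids = g '' PreEdge.addrs D.edges := by
  rw [CGraph.ids, h.edges, PreEdge.ids_real_image]

theorem Realizes.map_iso {D : PreGraph L X} {s g : X → ℕ} {K K' : CGraph ar}
    (h : D.Realizes s g K) (hK : K.Iso K') : D.IsCopy K' := by
  obtain ⟨f, k, hf, hk, hv, he, hsrc⟩ := hK
  rw [h.verts] at hf hv
  rw [h.ids] at hk
  rw [h.edges] at he
  refine ⟨f ∘ s, k ∘ g, hf.comp h.s_inj (Set.mapsTo_image _ _),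
    hk.comp h.g_inj (Set.mapsTo_image _ _), ?_, ?_, ?_⟩
  · rw [hv, Set.image_image]; rfl
  · rw [he, Set.image_image]
    exact Set.image_congr fun e _ => by simp [PreEdge.real]
  · rw [hsrc, h.src, List.map_map]

theorem IsCopy.map_iso {D : PreGraph L X} {K K' : CGraph ar} (h : D.IsCopy K) (hK : K.Iso K') :
    D.IsCopy K' := by
  obtain ⟨s, g, h⟩ := h
  exact h.map_iso hK

theorem Realizes.iso {D : PreGraph L X} (hD : D.WF ar) {s g s' g' : X → ℕ} {K K' : CGraph ar}
    (h : D.Realizes s g K) (h' : D.Realizes s' g' K') : K.Iso K' := by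
  rcases isEmpty_or_nonempty X with hX | hX
  · have hv : D.verts = ∅ := Set.eq_empty_of_isEmpty _
    have he : D.edges = ∅ := Set.eq_empty_of_forall_notMem fun e => hX.elim e.addr
    have hs : D.src = [] := List.eq_nil_iff_forall_not_mem.2 fun x => hX.elim x
    refine ⟨id, id, Set.injOn_id _, Set.injOn_id _, ?_, ?_, ?_⟩
    · rw [h.verts, h'.verts, hv]; simp
    · rw [h.edges, h'.edges, he]; simp
    · rw [h.src, h'.src, hs]; simp
  · have hs : ∀ x ∈ D.verts, s' (Function.invFunOn s D.verts (s x)) = s' x := fun x hx => by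
      rw [h.s_inj.leftInvOn_invFunOn hx]
    have hg : ∀ x ∈ PreEdge.addrs D.edges,
        g' (Function.invFunOn g (PreEdge.addrs D.edges) (g x)) = g' x := fun x hx => by
      rw [h.g_inj.leftInvOn_invFunOn hx]
    refine ⟨s' ∘ Function.invFunOn s D.verts, g' ∘ Function.invFunOn g (PreEdge.addrs D.edges),
      ?_, ?_, ?_, ?_, ?_⟩
    · rw [h.verts]
      rintro _ ⟨x, hx, rfl⟩ _ ⟨y, hy, rfl⟩ hxy
      simp only [Function.comp, hs x hx, hs y hy] at hxy
      rw [h'.s_inj hx hy hxy]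
    · rw [h.ids]
      rintro _ ⟨x, hx, rfl⟩ _ ⟨y, hy, rfl⟩ hxy
      simp only [Function.comp, hg x hx, hg y hy] at hxy
      rw [h'.g_inj hx hy hxy]
    · rw [h.verts, h'.verts, Set.image_image]
      exact Set.image_congr fun x hx => (hs x hx).symm
    · rw [h.edges, h'.edges, Set.image_image]
      refine Set.image_congr fun e he => ?_
      simp only [PreEdge.real, List.map_map, Function.comp, hg _ (PreEdge.mem_addrs he)]
      congr 1
      exact List.map_congr_left fun x hx => (hs x (hD.att_mem e he x hx)).symm
    · rw [h.src, h'.src, List.map_map]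
      exact List.map_congr_left fun x hx => (hs x (hD.src_mem x hx)).symm

theorem Realizes.mono {D D' : PreGraph L X} (hD' : D'.WF ar) {s g : X → ℕ} {K : CGraph ar}
    (h : D.Realizes s g K) (hv : D'.verts ⊆ D.verts) (he : D'.edges ⊆ D.edges) :
    ∃ K' : CGraph ar, D'.Realizes s g K' :=
  hD'.exists_realizes (h.s_inj.mono hv) (h.g_inj.mono (Set.image_mono he))

end PreGraph

theorem CGraph.Iso.refl {Λ : Type u} {ar : Λ → ℕ} (G : CGraph ar) : G.Iso G :=
  ⟨id, id, Set.injOn_id _, Set.injOn_id _, by simp, by simp, by simp⟩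

namespace PreGraph

variable {L : Type u} {ar : L → ℕ} {X : Type v}

/-- The union of two graphs with the same sources. -/
def par (D₁ D₂ : PreGraph L X) : PreGraph L X :=
  ⟨D₁.verts ∪ D₂.verts, D₁.edges ∪ D₂.edges, D₁.src⟩

theorem isCopy_par {D₁ D₂ : PreGraph L X} (hD₁ : D₁.WF ar) (hD₂ : D₂.WF ar)
    (hsrc : D₁.src = D₂.src) (hv : ∀ x ∈ D₁.verts, x ∈ D₂.verts → x ∈ D₁.src)
    (he : Disjoint (PreEdge.addrs D₁.edges) (PreEdge.addrs D₂.edges)) (K : CGraph ar) :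
    (D₁.par D₂).IsCopy K ↔
      ∃ K₁ K₂ : CGraph ar, D₁.IsCopy K₁ ∧ D₂.IsCopy K₂ ∧ K₁.IsPar K₂ K := by
  constructor
  · rintro ⟨s, g, h⟩
    obtain ⟨K₁, h₁⟩ := h.mono hD₁ Set.subset_union_left Set.subset_union_left
    obtain ⟨K₂, h₂⟩ := h.mono hD₂ Set.subset_union_right Set.subset_union_right
    refine ⟨K₁, K₂, ⟨s, g, h₁⟩, ⟨s, g, h₂⟩, K₁, K₂, .refl _, .refl _, ?_, ?_, ?_, ?_, ?_, ?_⟩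
    · rw [h₁.src, h₂.src, hsrc]
    · rw [h₁.verts, h₂.verts, h₁.src]
      ext a
      constructor
      · rintro ⟨⟨x, hx, rfl⟩, y, hy, hxy⟩
        obtain rfl : y = x := h.s_inj (Or.inr hy) (Or.inl hx) hxy
        exact List.mem_map.2 ⟨y, hv y hx hy, rfl⟩
      · intro ha
        obtain ⟨x, hx, rfl⟩ := List.mem_map.1 ha
        exact ⟨⟨x, hD₁.src_mem x hx, rfl⟩, x, hD₂.src_mem x (hsrc ▸ hx), rfl⟩
    · rw [h₁.ids, h₂.ids]
      refine Set.disjoint_left.2 ?_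
      rintro _ ⟨x, hx, rfl⟩ ⟨y, hy, hxy⟩
      have hg := h.g_inj
      simp only [par, PreEdge.addrs_union] at hg
      obtain rfl : y = x := hg (Or.inr hy) (Or.inl hx) hxy
      exact Set.disjoint_left.1 he hx hy
    · rw [h.verts, h₁.verts, h₂.verts, par, Set.image_union]
    · rw [h.edges, h₁.edges, h₂.edges, par, Set.image_union]
    · rw [h.src, h₁.src, par]
  · rintro ⟨K₁, K₂, h₁, h₂, K₁', K₂', i₁, i₂, ksrc, kv, kid, hKv, hKe, hKs⟩
    obtain ⟨s₁, g₁, h₁⟩ := h₁.map_iso i₁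
    obtain ⟨s₂, g₂, h₂⟩ := h₂.map_iso i₂
    have hs12 : ∀ x ∈ D₂.src, s₁ x = s₂ x := by
      have := ksrc
      rw [h₁.src, h₂.src, hsrc] at this
      exact List.map_inj_left.1 this
    have cross : ∀ x ∈ D₁.verts, ∀ y ∈ D₂.verts, (s₁ x = s₂ y ↔ x = y) := by
      intro x hx y hy
      constructor
      · intro hxy
        have hmem : s₁ x ∈ K₁'.verts ∩ K₂'.verts := by
          rw [h₁.verts, h₂.verts]
          exact ⟨⟨x, hx, rfl⟩, y, hy, hxy.symm⟩
        rw [kv, ksrc, h₂.src] at hmem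
        obtain ⟨z, hz, hzx⟩ := List.mem_map.1 hmem
        have hzy : z = y := h₂.s_inj (hD₂.src_mem z hz) hy (hzx.trans hxy)
        have hzx' : z = x := h₁.s_inj (hD₁.src_mem z (hsrc ▸ hz)) hx ((hs12 z hz).trans hzx)
        exact hzx'.symm.trans hzy
      · rintro rfl
        exact hs12 x (hsrc ▸ hv x hx hy)
    obtain ⟨s, hs₁, hs₂, hsi⟩ := exists_glue_injOn_union h₁.s_inj h₂.s_inj cross
    have gcross : ∀ x ∈ PreEdge.addrs D₁.edges, ∀ y ∈ PreEdge.addrs D₂.edges,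
        (g₁ x = g₂ y ↔ x = y) := by
      intro x hx y hy
      rw [h₁.ids, h₂.ids] at kid
      constructor
      · intro hxy
        exact (Set.disjoint_left.1 kid ⟨x, hx, rfl⟩ ⟨y, hy, hxy.symm⟩).elim
      · rintro rfl
        exact (Set.disjoint_left.1 he hx hy).elim
    obtain ⟨g, hg₁, hg₂, hgi⟩ := exists_glue_injOn_union h₁.g_inj h₂.g_inj gcross
    refine ⟨s, g, hsi, ?_, ?_, ?_, ?_⟩
    · simpa only [par, PreEdge.addrs_union] using hgi
    · rw [hKv, h₁.verts, h₂.verts, par, Set.image_union, hs₁.image_eq, hs₂.image_eq]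
    · rw [hKe, h₁.edges, h₂.edges, par, Set.image_union,
        PreEdge.image_real_congr hD₁.att_mem hs₁ hg₁,
        PreEdge.image_real_congr hD₂.att_mem hs₂ hg₂]
    · rw [hKs, h₁.src]
      exact List.map_congr_left fun x hx => (hs₁ (hD₁.src_mem x hx)).symm

/-- The union of `D₀` and of the graphs `D i`, with the sources of `D₀`. -/
def plug {k : ℕ} (D₀ : PreGraph L X) (D : Fin k → PreGraph L X) : PreGraph L X :=
  ⟨D₀.verts ∪ ⋃ i, (D i).verts, D₀.edges ∪ ⋃ i, (D i).edges, D₀.src⟩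

/-- The graphs `D i` meet `D₀` exactly in their sources, and each other only within `D₀`. -/
structure Pluggable {k : ℕ} (D₀ : PreGraph L X) (D : Fin k → PreGraph L X) : Prop where
  src_mem : ∀ i, ∀ x ∈ (D i).src, x ∈ D₀.verts
  mem_src : ∀ i, ∀ x ∈ (D i).verts, x ∈ D₀.verts → x ∈ (D i).src
  verts : ∀ i j, i ≠ j → ∀ x ∈ (D i).verts, x ∈ (D j).verts → x ∈ D₀.verts
  base_edges : ∀ i, Disjoint (PreEdge.addrs (D i).edges) (PreEdge.addrs D₀.edges)
  edges : ∀ i j, i ≠ j → Disjoint (PreEdge.addrs (D i).edges) (PreEdge.addrs (D j).edges)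

theorem Pluggable.wf {k : ℕ} {D₀ : PreGraph L X} {D : Fin k → PreGraph L X}
    (hp : Pluggable D₀ D) (h₀ : D₀.WF ar) (hD : ∀ i, (D i).WF ar) : (D₀.plug D).WF ar where
  verts_finite := h₀.verts_finite.union (Set.finite_iUnion fun i => (hD i).verts_finite)
  edges_finite := h₀.edges_finite.union (Set.finite_iUnion fun i => (hD i).edges_finite)
  addr_inj := by
    rintro e (he | he) e' (he' | he') h
    · exact h₀.addr_inj he he' h
    · obtain ⟨i, hi⟩ := Set.mem_iUnion.1 he'
      exact (Set.disjoint_left.1 (hp.base_edges i) (PreEdge.mem_addrs hi)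
        (h ▸ PreEdge.mem_addrs he)).elim
    · obtain ⟨i, hi⟩ := Set.mem_iUnion.1 he
      exact (Set.disjoint_left.1 (hp.base_edges i) (PreEdge.mem_addrs hi)
        (h ▸ PreEdge.mem_addrs he')).elim
    · obtain ⟨i, hi⟩ := Set.mem_iUnion.1 he
      obtain ⟨j, hj⟩ := Set.mem_iUnion.1 he'
      by_cases hij : i = j
      · subst hij
        exact (hD i).addr_inj hi hj h
      · exact (Set.disjoint_left.1 (hp.edges i j hij) (PreEdge.mem_addrs hi)
          (h ▸ PreEdge.mem_addrs hj)).elim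
  att_length := by
    rintro e (he | he)
    · exact h₀.att_length e he
    · obtain ⟨i, hi⟩ := Set.mem_iUnion.1 he
      exact (hD i).att_length e hi
  att_mem := by
    rintro e (he | he) x hx
    · exact Or.inl (h₀.att_mem e he x hx)
    · obtain ⟨i, hi⟩ := Set.mem_iUnion.1 he
      exact Or.inr (Set.mem_iUnion.2 ⟨i, (hD i).att_mem e hi x hx⟩)
  src_mem := fun x hx => Or.inl (h₀.src_mem x hx)
  src_nodup := h₀.src_nodup

theorem par_wf {D₁ D₂ : PreGraph L X} (hD₁ : D₁.WF ar) (hD₂ : D₂.WF ar)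
    (he : Disjoint (PreEdge.addrs D₁.edges) (PreEdge.addrs D₂.edges)) : (D₁.par D₂).WF ar where
  verts_finite := hD₁.verts_finite.union hD₂.verts_finite
  edges_finite := hD₁.edges_finite.union hD₂.edges_finite
  addr_inj := by
    rintro e (h | h) e' (h' | h') hee
    · exact hD₁.addr_inj h h' hee
    · exact (Set.disjoint_left.1 he (PreEdge.mem_addrs h) (hee ▸ PreEdge.mem_addrs h')).elim
    · exact (Set.disjoint_left.1 he (PreEdge.mem_addrs h') (hee ▸ PreEdge.mem_addrs h)).elim
    · exact hD₂.addr_inj h h' hee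
  att_length := by
    rintro e (h | h)
    · exact hD₁.att_length e h
    · exact hD₂.att_length e h
  att_mem := by
    rintro e (h | h) x hx
    · exact Or.inl (hD₁.att_mem e h x hx)
    · exact Or.inr (hD₂.att_mem e h x hx)
  src_mem := fun x hx => Or.inl (hD₁.src_mem x hx)
  src_nodup := hD₁.src_nodup

/-- `G` and the list `es` of its nonterminal edges are the image of `D₀`, with a nonterminal edge
attached to the sources of each `D i`. -/
structure Frames {N : Type*} {arN : N → ℕ} {k : ℕ} (D₀ : PreGraph L X) (D : Fin k → PreGraph L X)
    (s g : X → ℕ) (G : CGraph (Sum.elim ar arN)) (es : List (HEdge N)) : Prop where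
  s_inj : Set.InjOn s D₀.verts
  g_inj : Set.InjOn g (PreEdge.addrs D₀.edges)
  verts : G.verts = s '' D₀.verts
  edges : HRRhs.termEdges G = PreEdge.real s g '' D₀.edges
  src : G.src = D₀.src.map s
  length : es.length = k
  att : ∀ i : Fin k, (es.get (i.cast length.symm)).att = (D i).src.map s

/-- An injective map on a finite set extends to an injective map that takes new values elsewhere. -/
theorem exists_injective_extension {X : Type*} [Encodable X] {V : Set X} (hV : V.Finite)
    {s : X → ℕ} (hs : Set.InjOn s V) :
    ∃ t : X → ℕ, Set.EqOn t s V ∧ Function.Injective t := by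
  classical
  obtain ⟨M, hM⟩ := (hV.image s).bddAbove
  have hlt : ∀ x ∈ V, s x ≤ M := fun x hx => hM ⟨x, hx, rfl⟩
  refine ⟨fun x => if x ∈ V then s x else M + 1 + Encodable.encode x,
    fun x hx => if_pos hx, ?_⟩
  intro x y hxy
  by_cases hx : x ∈ V <;> by_cases hy : y ∈ V <;> simp only [hx, hy, if_true, if_false] at hxy
  · exact hs hx hy hxy
  · have := hlt x hx; omega
  · have := hlt y hy; omega
  · exact Encodable.encode_injective (by omega)

theorem Frames.exists_isSubst [Encodable X] {N : Type*} {arN : N → ℕ} {k : ℕ} {D₀ : PreGraph L X}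
    {D : Fin k → PreGraph L X} {s₀ g₀ : X → ℕ} {G : CGraph (Sum.elim ar arN)}
    {es : List (HEdge N)} (hF : Frames D₀ D s₀ g₀ G es) (hp : Pluggable D₀ D) (h₀ : D₀.WF ar)
    (hD : ∀ i, (D i).WF ar) {K : CGraph ar} (hK : (D₀.plug D).IsCopy K) :
    ∃ (H : Fin k → CGraph ar) (K₁ : CGraph ar), (∀ i, (D i).IsCopy (H i)) ∧
      HRRhs.IsSubst G es H K₁ ∧ K₁.Iso K := by
  obtain ⟨s', g', hK⟩ := hK
  obtain ⟨s, hss, hs⟩ := exists_injective_extension h₀.verts_finite hF.s_inj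
  obtain ⟨g, hgg, hg⟩ := exists_injective_extension (h₀.edges_finite.image _) hF.g_inj
  obtain ⟨K₁, hK₁⟩ := (hp.wf h₀ hD).exists_realizes (s := s) (g := g) hs.injOn hg.injOn
  choose H hH using fun i => (hD i).exists_realizes (s := s) (g := g) hs.injOn hg.injOn
  have hGv : G.verts = s '' D₀.verts := hF.verts.trans hss.image_eq.symm
  have hGe : HRRhs.termEdges G = PreEdge.real s g '' D₀.edges :=
    hF.edges.trans (PreEdge.image_real_congr h₀.att_mem hss hgg).symm
  refine ⟨H, K₁, fun i => ⟨s, g, hH i⟩, ⟨hF.length, H, fun i => .refl _, ?_, ?_, ?_, ?_, ?_, ?_, ?_,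
    ?_⟩, hK₁.iso (hp.wf h₀ hD) hK⟩
  · intro i
    rw [hF.att, (hH i).src]
    exact List.map_congr_left fun x hx => hss (hp.src_mem i x hx)
  · intro i
    rw [(hH i).verts, hGv, (hH i).src]
    ext a
    constructor
    · rintro ⟨⟨x, hx, rfl⟩, y, hy, hxy⟩
      obtain rfl := hs hxy
      exact List.mem_map.2 ⟨y, hp.mem_src i y hx hy, rfl⟩
    · intro ha
      obtain ⟨x, hx, rfl⟩ := List.mem_map.1 ha
      exact ⟨⟨x, (hD i).src_mem x hx, rfl⟩, x, hp.src_mem i x hx, rfl⟩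
  · intro i j hij
    rw [(hH i).verts, (hH j).verts, hGv]
    rintro _ ⟨⟨x, hx, rfl⟩, y, hy, hxy⟩
    obtain rfl := hs hxy
    exact ⟨y, hp.verts i j hij y hx hy, rfl⟩
  · intro i
    rw [(hH i).ids, hGe, PreEdge.ids_real_image]
    exact (Set.disjoint_image_iff hg).2 (hp.base_edges i)
  · intro i j hij
    rw [(hH i).ids, (hH j).ids]
    exact (Set.disjoint_image_iff hg).2 (hp.edges i j hij)
  · simp only [hK₁.verts, hGv, (hH _).verts, plug, Set.image_union, Set.image_iUnion]
  · simp only [hK₁.edges, hGe, (hH _).edges, plug, Set.image_union, Set.image_iUnion]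
  · rw [hK₁.src, hF.src]
    exact List.map_congr_left fun x hx => hss (h₀.src_mem x hx)

theorem Frames.isCopy_of_isSubst {N : Type*} {arN : N → ℕ} {k : ℕ} {D₀ : PreGraph L X}
    {D : Fin k → PreGraph L X} {s₀ g₀ : X → ℕ} {G : CGraph (Sum.elim ar arN)}
    {es : List (HEdge N)} (hF : Frames D₀ D s₀ g₀ G es) (hp : Pluggable D₀ D) (h₀ : D₀.WF ar)
    (hD : ∀ i, (D i).WF ar) {H : Fin k → CGraph ar} {K : CGraph ar}
    (hH : ∀ i, (D i).IsCopy (H i)) (hK : HRRhs.IsSubst G es H K) : (D₀.plug D).IsCopy K := by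
  obtain ⟨_, H', hiso, hsrc, hvG, hvv, hidG, hid, hKv, hKe, hKs⟩ := hK
  choose s g hr using fun i => (hH i).map_iso (hiso i)
  have hagree : ∀ i, ∀ x ∈ (D i).src, s i x = s₀ x := by
    intro i
    have := hsrc i
    rw [hF.att, (hr i).src] at this
    exact List.map_inj_left.1 this
  have cross₀ : ∀ i, ∀ x ∈ (D i).verts, ∀ y ∈ D₀.verts, (s i x = s₀ y ↔ x = y) := by
    intro i x hx y hy
    constructor
    · intro hxy
      have hmem : s i x ∈ (H' i).verts ∩ G.verts := by
        rw [(hr i).verts, hF.verts]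
        exact ⟨⟨x, hx, rfl⟩, y, hy, hxy.symm⟩
      rw [hvG, (hr i).src] at hmem
      obtain ⟨z, hz, hzx⟩ := List.mem_map.1 hmem
      have h1 : z = x := (hr i).s_inj ((hD i).src_mem z hz) hx hzx
      have h2 : z = y := hF.s_inj (hp.src_mem i z hz) hy
        ((hagree i z hz).symm.trans (hzx.trans hxy))
      exact h1.symm.trans h2
    · rintro rfl
      exact hagree i x (hp.mem_src i x hx hy)
  obtain ⟨s₁, hs₁, hs₁i⟩ := exists_glue_injOn (fun i => (D i).verts) s (by
    intro i j x hx y hy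
    by_cases hij : i = j
    · subst hij
      exact (hr i).s_inj.eq_iff hx hy
    constructor
    · intro hxy
      have hmem : s i x ∈ (H' i).verts ∩ (H' j).verts := by
        rw [(hr i).verts, (hr j).verts]
        exact ⟨⟨x, hx, rfl⟩, y, hy, hxy.symm⟩
      have hmem' := hvv i j hij hmem
      rw [hF.verts] at hmem'
      obtain ⟨z, hz, hzx⟩ := hmem'
      exact ((cross₀ i x hx z hz).1 hzx.symm).trans
        ((cross₀ j y hy z hz).1 (hxy.symm.trans hzx.symm)).symm
    · rintro rfl
      have hx₀ := hp.verts i j hij x hx hy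
      rw [(cross₀ i x hx x hx₀).2 rfl, (cross₀ j x hy x hx₀).2 rfl])
  obtain ⟨t, ht₀, ht₁, hti⟩ := exists_glue_injOn_union hF.s_inj hs₁i (by
    intro x hx y hy
    obtain ⟨i, hi⟩ := Set.mem_iUnion.1 hy
    rw [hs₁ i hi, eq_comm, cross₀ i y hi x hx, eq_comm])
  obtain ⟨g₁, hg₁, hg₁i⟩ := exists_glue_injOn (fun i => PreEdge.addrs (D i).edges) g (by
    intro i j x hx y hy
    by_cases hij : i = j
    · subst hij
      exact (hr i).g_inj.eq_iff hx hy
    have hd := hid i j hij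
    rw [(hr i).ids, (hr j).ids] at hd
    constructor
    · intro hxy
      exact (Set.disjoint_left.1 hd ⟨x, hx, rfl⟩ ⟨y, hy, hxy.symm⟩).elim
    · rintro rfl
      exact (Set.disjoint_left.1 (hp.edges i j hij) hx hy).elim)
  obtain ⟨r, hr₀, hr₁, hri⟩ := exists_glue_injOn_union hF.g_inj hg₁i (by
    intro x hx y hy
    obtain ⟨i, hi⟩ := Set.mem_iUnion.1 hy
    rw [hg₁ i hi]
    have hd := hidG i
    rw [(hr i).ids, hF.edges, PreEdge.ids_real_image] at hd
    constructor
    · intro hxy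
      exact (Set.disjoint_left.1 hd ⟨y, hi, rfl⟩ ⟨x, hx, hxy⟩).elim
    · rintro rfl
      exact (Set.disjoint_left.1 (hp.base_edges i) hi hx).elim)
  have hti' : ∀ i, Set.EqOn t (s i) (D i).verts := fun i x hx =>
    (ht₁ (Set.mem_iUnion.2 ⟨i, hx⟩)).trans (hs₁ i hx)
  have hri' : ∀ i, Set.EqOn r (g i) (PreEdge.addrs (D i).edges) := fun i x hx =>
    (hr₁ (Set.mem_iUnion.2 ⟨i, hx⟩)).trans (hg₁ i hx)
  refine ⟨t, r, hti, ?_, ?_, ?_, ?_⟩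
  · simpa only [plug, PreEdge.addrs_union, PreEdge.addrs_iUnion] using hri
  · simp only [hKv, plug, Set.image_union, Set.image_iUnion, ht₀.image_eq, (hti' _).image_eq,
      hF.verts, (hr _).verts]
  · simp only [hKe, plug, Set.image_union, Set.image_iUnion, hF.edges, (hr _).edges,
      PreEdge.image_real_congr h₀.att_mem ht₀ hr₀,
      PreEdge.image_real_congr (hD _).att_mem (hti' _) (hri' _)]
  · rw [hKs, hF.src]
    exact List.map_congr_left fun x hx => (ht₀ (h₀.src_mem x hx)).symm

end PreGraph

/-! ## Satisfaction in terms of edge occurrences -/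

/-- The equality or disequality expressed by an atom holds in the store `s`. -/
def Atom.Pure {L : Type u} {ar : L → ℕ} {V : Type*} (s : V → ℕ) : Atom ar V → Prop
  | eq x y => s x = s y
  | neq x y => s x ≠ s y
  | rel _ _ => True

/-- The vertices attached to a set of edges. -/
def PreEdge.attVerts {L : Type u} {X : Type v} (E : Set (PreEdge L X)) : Set X :=
  {x | ∃ e ∈ E, x ∈ e.att}

theorem PreEdge.attVerts_union {L : Type u} {X : Type v} (E F : Set (PreEdge L X)) :
    attVerts (E ∪ F) = attVerts E ∪ attVerts F := by
  ext x
  simp only [attVerts, Set.mem_ofPred_eq, Set.mem_union, or_and_right, exists_or]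

/-- The subgraph that consists of the edges in `F` and of the vertices attached to them. -/
def CGraph.edgeSubgraph {Λ : Type u} {ar : Λ → ℕ} (G : CGraph ar) (F : Set (HEdge Λ))
    (hF : F ⊆ G.edges) : CGraph ar where
  verts := {x | ∃ e ∈ F, x ∈ e.att}
  edges := F
  src := []
  verts_finite := G.verts_finite.subset fun x ⟨e, he, hx⟩ => G.att_mem e (hF he) x hx
  edges_finite := G.edges_finite.subset hF
  id_inj := fun e he e' he' h => G.id_inj e (hF he) e' (hF he') h
  att_length := fun e he => G.att_length e (hF he)
  att_mem := fun e he x hx => ⟨e, he, hx⟩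
  src_mem := by simp
  src_nodup := List.nodup_nil

/-- `E` lists the occurrences of relation atoms in `φ`, with pairwise distinct identities. -/
structure QFormula.Describes {L : Type u} {ar : L → ℕ} {X : Type v} (φ : QFormula ar X)
    (E : Set (PreEdge L X)) : Prop where
  sat_iff : ∀ (s : X → ℕ) (G : CGraph ar), φ.Sat s G ↔ (∀ a ∈ φ.atoms, a.Pure s) ∧
    ∃ g : X → ℕ, Set.InjOn g (PreEdge.addrs E) ∧ G.verts = s '' PreEdge.attVerts E ∧
      G.edges = PreEdge.real s g '' E
  rel_mem : ∀ e ∈ E, ∃ xs, e.att = List.ofFn xs ∧ Atom.rel e.lab xs ∈ φ.atoms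

namespace QFormula

variable {L : Type u} {ar : L → ℕ} {X : Type v}

theorem describes_emp : (emp : QFormula ar X).Describes ∅ where
  sat_iff s G := by
    simp [Sat, atoms, PreEdge.addrs, PreEdge.attVerts]
  rel_mem := by simp

theorem describes_eq (x y : X) : (atom (.eq x y) : QFormula ar X).Describes ∅ where
  sat_iff s G := by
    simp [Sat, Atom.Sat, Atom.Pure, atoms, PreEdge.addrs, PreEdge.attVerts, and_comm,
      and_left_comm]
  rel_mem := by simp

theorem describes_neq (x y : X) : (atom (.neq x y) : QFormula ar X).Describes ∅ where
  sat_iff s G := by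
    simp [Sat, Atom.Sat, Atom.Pure, atoms, PreEdge.addrs, PreEdge.attVerts, and_comm,
      and_left_comm]
  rel_mem := by simp

theorem describes_rel (r : L) (xs : Fin (ar r) → X) (ι : X) :
    (atom (.rel r xs) : QFormula ar X).Describes {⟨ι, r, List.ofFn xs⟩} where
  sat_iff s G := by
    have hv : s '' PreEdge.attVerts {(⟨ι, r, List.ofFn xs⟩ : PreEdge L X)} =
        Set.range fun i => s (xs i) := by
      ext a
      simp [PreEdge.attVerts]
    simp only [Sat, Atom.Sat, atoms, hv, List.mem_singleton, forall_eq, Atom.Pure, true_and,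
      PreEdge.addrs, Set.image_singleton, Set.injOn_singleton, PreEdge.real, List.map_ofFn]
    constructor
    · rintro ⟨h, k, hk⟩
      exact ⟨fun _ => k, h, hk⟩
    · rintro ⟨g, h, hk⟩
      exact ⟨h, g ι, hk⟩
  rel_mem := by simp [atoms]

theorem Describes.star {φ ψ : QFormula ar X} {E F : Set (PreEdge L X)} (hφ : φ.Describes E)
    (hψ : ψ.Describes F) (hEF : Disjoint (PreEdge.addrs E) (PreEdge.addrs F)) :
    (φ.star ψ).Describes (E ∪ F) where
  sat_iff s G := by
    simp only [Sat, hφ.sat_iff, hψ.sat_iff, atoms, List.mem_append, or_imp, forall_and,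
      PreEdge.addrs_union, PreEdge.attVerts_union, Set.image_union]
    constructor
    · rintro ⟨G₁, G₂, -, -, hd, hv, he, ⟨p₁, g₁, i₁, v₁, e₁⟩, p₂, g₂, i₂, v₂, e₂⟩
      obtain ⟨g, hg₁, hg₂, hg⟩ := exists_glue_injOn_union i₁ i₂ (by
        intro x hx y hy
        rw [CGraph.ids, CGraph.ids, e₁, e₂, PreEdge.ids_real_image, PreEdge.ids_real_image] at hd
        constructor
        · intro hxy
          exact (Set.disjoint_left.1 hd ⟨x, hx, rfl⟩ ⟨y, hy, hxy.symm⟩).elim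
        · rintro rfl
          exact (Set.disjoint_left.1 hEF hx hy).elim)
      refine ⟨⟨p₁, p₂⟩, g, hg, by rw [hv, v₁, v₂], ?_⟩
      rw [he, e₁, e₂,
        PreEdge.image_real_congr (V := Set.univ) (by simp) (Set.eqOn_refl s _) hg₁,
        PreEdge.image_real_congr (V := Set.univ) (by simp) (Set.eqOn_refl s _) hg₂]
    · rintro ⟨⟨p₁, p₂⟩, g, hg, hv, he⟩
      have hverts : ∀ E' : Set (PreEdge L X),
          {x | ∃ e ∈ PreEdge.real s g '' E', x ∈ e.att} = s '' PreEdge.attVerts E' := by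
        intro E'
        ext x
        constructor
        · rintro ⟨_, ⟨e, he', rfl⟩, hx⟩
          obtain ⟨y, hy, rfl⟩ := List.mem_map.1 hx
          exact ⟨y, ⟨e, he', hy⟩, rfl⟩
        · rintro ⟨y, ⟨e, he', hy⟩, rfl⟩
          exact ⟨_, ⟨e, he', rfl⟩, List.mem_map.2 ⟨y, hy, rfl⟩⟩
      refine ⟨G.edgeSubgraph (PreEdge.real s g '' E) (he ▸ Set.subset_union_left),
        G.edgeSubgraph (PreEdge.real s g '' F) (he ▸ Set.subset_union_right), rfl, rfl, ?_, ?_, he,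
        ⟨p₁, g, hg.mono Set.subset_union_left, hverts E, rfl⟩,
        ⟨p₂, g, hg.mono Set.subset_union_right, hverts F, rfl⟩⟩
      · simp only [CGraph.ids, CGraph.edgeSubgraph, PreEdge.ids_real_image]
        refine Set.disjoint_left.2 ?_
        rintro _ ⟨x, hx, rfl⟩ ⟨y, hy, hxy⟩
        obtain rfl := hg (Or.inr hy) (Or.inl hx) hxy
        exact Set.disjoint_left.1 hEF hx hy
      · exact hv.trans (congrArg₂ _ (hverts E).symm (hverts F).symm)
  rel_mem := by
    rintro e (he | he)
    · obtain ⟨xs, h, h'⟩ := hφ.rel_mem e he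
      exact ⟨xs, h, List.mem_append_left _ h'⟩
    · obtain ⟨xs, h, h'⟩ := hψ.rel_mem e he
      exact ⟨xs, h, List.mem_append_right _ h'⟩

/-- The occurrences of relation atoms in `φ` under the substitution `σ`; the occurrence with
position `i` has the identity `ι i`. -/
def relEdges {V : Type*} (σ : V → X) (ι : ℕ → X) (φ : QFormula ar V) : Set (PreEdge L X) :=
  {e | ∃ i r xs, φ.atoms[i]? = some (.rel r xs) ∧ e = ⟨ι i, r, List.ofFn fun t => σ (xs t)⟩}

theorem relEdges_star {V : Type*} (σ : V → X) (ι : ℕ → X) (φ ψ : QFormula ar V) :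
    relEdges σ ι (φ.star ψ) =
      relEdges σ ι φ ∪ relEdges σ (fun i => ι (φ.atoms.length + i)) ψ := by
  ext e
  simp only [relEdges, atoms, Set.mem_ofPred_eq, Set.mem_union]
  constructor
  · rintro ⟨i, r, xs, h, rfl⟩
    by_cases hi : i < φ.atoms.length
    · rw [List.getElem?_append_left hi] at h
      exact Or.inl ⟨i, r, xs, h, rfl⟩
    · rw [List.getElem?_append_right (not_lt.1 hi)] at h
      refine Or.inr ⟨_, r, xs, h, ?_⟩
      rw [Nat.add_sub_cancel' (not_lt.1 hi)]
  · rintro (⟨i, r, xs, h, rfl⟩ | ⟨i, r, xs, h, rfl⟩)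
    · refine ⟨i, r, xs, ?_, rfl⟩
      obtain ⟨hi, -⟩ := List.getElem?_eq_some_iff.1 h
      rwa [List.getElem?_append_left hi]
    · refine ⟨_, r, xs, ?_, rfl⟩
      rwa [List.getElem?_append_right (Nat.le_add_right _ _), Nat.add_sub_cancel_left]

theorem addrs_relEdges_subset {V : Type*} (σ : V → X) (ι : ℕ → X) (φ : QFormula ar V) :
    PreEdge.addrs (relEdges σ ι φ) ⊆ ι '' {i | i < φ.atoms.length} := by
  rintro _ ⟨_, ⟨i, r, xs, h, rfl⟩, rfl⟩
  exact ⟨i, (List.getElem?_eq_some_iff.1 h).1, rfl⟩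

theorem describes_subst {V : Type*} (σ : V → X) (ι : ℕ → X) (hι : Function.Injective ι)
    (φ : QFormula ar V) : (φ.subst σ).Describes (relEdges σ ι φ) := by
  induction φ generalizing ι with
  | emp =>
    have : relEdges σ ι (emp : QFormula ar V) = ∅ := by simp [relEdges, atoms]
    rw [this]
    exact describes_emp
  | atom a =>
    cases a with
    | eq x y =>
      have : relEdges σ ι (atom (.eq x y) : QFormula ar V) = ∅ := by
        ext e; simp [relEdges, atoms, List.getElem?_singleton]
      rw [this]
      exact describes_eq _ _
    | neq x y =>
      have : relEdges σ ι (atom (.neq x y) : QFormula ar V) = ∅ := by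
        ext e; simp [relEdges, atoms, List.getElem?_singleton]
      rw [this]
      exact describes_neq _ _
    | rel r xs =>
      have : relEdges σ ι (atom (.rel r xs) : QFormula ar V) =
          {⟨ι 0, r, List.ofFn fun t => σ (xs t)⟩} := by
        ext e
        constructor
        · rintro ⟨i, r', xs', h, rfl⟩
          rw [atoms, List.getElem?_singleton] at h
          split_ifs at h with hi
          subst hi
          cases h
          rfl
        · rintro rfl
          exact ⟨0, r, xs, rfl, rfl⟩
      rw [this]
      exact describes_rel r (fun t => σ (xs t)) (ι 0)
  | star φ ψ ihφ ihψ =>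
    rw [relEdges_star]
    refine (ihφ ι hι).star (ihψ _ fun i j h => Nat.add_left_cancel (hι h)) ?_
    refine Set.disjoint_left.2 fun x hx hy => ?_
    obtain ⟨i, hi, rfl⟩ := addrs_relEdges_subset σ ι φ hx
    obtain ⟨j, -, hj⟩ := addrs_relEdges_subset σ _ ψ hy
    have := hι hj
    simp only [Set.mem_ofPred_eq] at hi
    omega

theorem describes_bigStar {k : ℕ} (φ : Fin k → QFormula ar X) (E : Fin k → Set (PreEdge L X))
    (h : ∀ i, (φ i).Describes (E i))
    (hd : ∀ i j, i ≠ j → Disjoint (PreEdge.addrs (E i)) (PreEdge.addrs (E j))) :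
    (bigStar (List.ofFn φ)).Describes (⋃ i, E i) := by
  induction k with
  | zero =>
    simp only [List.ofFn_zero, Set.iUnion_of_empty]
    exact describes_emp
  | succ k ih =>
    have hE : ⋃ i, E i = E 0 ∪ ⋃ i : Fin k, E i.succ := by
      ext x
      simp only [Set.mem_iUnion, Set.mem_union, Fin.exists_fin_succ]
    rw [List.ofFn_succ, hE]
    refine (h 0).star (ih _ _ (fun i => h i.succ)
      fun i j hij => hd _ _ fun h => hij (Fin.succ_injective _ h)) ?_
    rw [PreEdge.addrs_iUnion, Set.disjoint_iUnion_right]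
    exact fun i => hd _ _ (Fin.succ_ne_zero i).symm

theorem mem_atoms_bigStar (l : List (QFormula ar X)) (a : Atom ar X) :
    a ∈ (bigStar l).atoms ↔ ∃ φ ∈ l, a ∈ φ.atoms := by
  induction l with
  | nil => simp [bigStar, atoms]
  | cons φ l ih =>
    have : (bigStar (φ :: l)).atoms = φ.atoms ++ (bigStar l).atoms := rfl
    rw [this, List.mem_append, ih]
    simp

theorem atoms_subst {V : Type*} (σ : V → X) (φ : QFormula ar V) :
    (φ.subst σ).atoms = φ.atoms.map (Atom.subst σ) := by
  induction φ with
  | emp => rfl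
  | atom a => rfl
  | star φ ψ ihφ ihψ => simp [subst, atoms, ihφ, ihψ]

end QFormula

/-! ## The graph described by a parse tree -/

namespace SID

variable {L : Type u} {ar : L → ℕ} {P : Type v} {arP : P → ℕ}

/-- The variables whose address extends `p`. -/
def Below (p : List ℕ) : Set TVar := {x | p <:+ x.1}

theorem below_cons_subset (c : ℕ) (p : List ℕ) : Below (c :: p) ⊆ Below p :=
  fun _ hx => (List.suffix_cons c p).trans hx

theorem mk_mem_below (p : List ℕ) (j : ℕ) : ((p, j) : TVar) ∈ Below p := List.suffix_rfl

theorem mk_notMem_below_cons (c : ℕ) (p : List ℕ) (j : ℕ) : ((p, j) : TVar) ∉ Below (c :: p) := by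
  intro h
  have := List.IsSuffix.length_le h
  simp at this

theorem below_cons_disjoint {c d : ℕ} (hcd : c ≠ d) (p : List ℕ) :
    Disjoint (Below (c :: p)) (Below (d :: p)) := by
  refine Set.disjoint_left.2 fun x hc hd => hcd ?_
  have h := List.suffix_of_suffix_length_le hc hd (by simp)
  have := h.eq_of_length (by simp)
  simpa using this

/-- The actual arguments of the `i`-th predicate atom of a rule. -/
def callArgs (ρ : SIDRule ar arP) (args : List TVar) (p : List ℕ) (i : ℕ) : List TVar :=
  ((ρ.calls[i]?).map (fun c => List.ofFn (fun j => inst args p (c.args j)))).getD []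

/-- The actual arguments `args` are as many as `n`, pairwise distinct, and not among the variables
introduced by edges whose address extends `p`. -/
structure FreshArgs (args : List TVar) (p : List ℕ) (n : ℕ) : Prop where
  nodup : args.Nodup
  length : args.length = n
  notMem : ∀ x ∈ args, x ∉ Below p

theorem FreshArgs.cons {args : List TVar} {p : List ℕ} {n : ℕ} (h : FreshArgs args p n) (c : ℕ) :
    FreshArgs args (c :: p) n :=
  ⟨h.nodup, h.length, fun x hx hx' => h.notMem x hx (below_cons_subset c p hx')⟩

theorem FreshArgs.inst_inl {args : List TVar} {p : List ℕ} {n m : ℕ} (h : FreshArgs args p n)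
    (i : Fin n) : inst (m := m) args p (.inl i) = args[(i : ℕ)]'(h.length ▸ i.2) := by
  rw [inst, List.getD_eq_getElem _ _ (h.length ▸ i.2)]

theorem FreshArgs.inst_inl_mem {args : List TVar} {p : List ℕ} {n m : ℕ} (h : FreshArgs args p n)
    (i : Fin n) : inst (m := m) args p (.inl i) ∈ args := by
  rw [h.inst_inl]
  exact List.getElem_mem _

theorem FreshArgs.inst_injective {args : List TVar} {p : List ℕ} {n m : ℕ}
    (h : FreshArgs args p n) : Function.Injective (inst (n := n) (m := m) args p) := by
  rintro (i | i) (j | j) hij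
  · rw [h.inst_inl, h.inst_inl, h.nodup.getElem_inj_iff] at hij
    rw [Fin.ext hij]
  · exact (h.notMem _ (h.inst_inl_mem i) (by rw [hij]; exact mk_mem_below p j)).elim
  · exact (h.notMem _ (h.inst_inl_mem j) (by rw [← hij]; exact mk_mem_below p i)).elim
  · simp only [inst, Prod.mk.injEq, true_and] at hij
    rw [Fin.ext hij]

theorem FreshArgs.map_inst {args : List TVar} {p : List ℕ} {n m : ℕ} (h : FreshArgs args p n) :
    List.ofFn (fun i : Fin n => inst (m := m) args p (.inl i)) = args := by
  refine List.ext_getElem (by simp [h.length]) fun i h₁ h₂ => ?_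
  rw [List.getElem_ofFn, h.inst_inl]

/-- The graph of the relation atoms of a rule. -/
def ruleBase (ρ : SIDRule ar arP) (args : List TVar) (p : List ℕ) : PreGraph L TVar :=
  ⟨Set.range (inst (n := arP ρ.head) (m := ρ.m) args p),
    ρ.psi.relEdges (inst args p) (fun i => (p, i)), args⟩

/-- The graph described by a tree whose root has the actual parameters `args`. -/
def stdGraph {Δ : SID ar arP} : PTree Δ.rules → List TVar → List ℕ → PreGraph L TVar
  | PTree.leaf, args, _ => ⟨{x | x ∈ args}, ∅, args⟩
  | PTree.edge ρ k sub rest, args, p =>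
      ((ruleBase ρ.1 args p).plug fun i : Fin k =>
        stdGraph (sub i) (callArgs ρ.1 args p i) (((i : ℕ) + 1) :: p)).par
      (stdGraph rest args (0 :: p))

/-- The arities of the predicates agree along the tree, all rules are productive, and every
predicate atom is unfolded. -/
def WellTyped {Δ : SID ar arP} : PTree Δ.rules → ℕ → Prop
  | PTree.leaf, _ => True
  | PTree.edge ρ k sub rest, n =>
      ¬ ρ.1.Unproductive ∧ arP ρ.1.head = n ∧ ρ.1.calls.length = k ∧
      (∀ i : Fin k, sub i ≠ PTree.leaf ∧
        ∀ c, ρ.1.calls[(i : ℕ)]? = some c → WellTyped (sub i) (arP c.pred)) ∧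
      WellTyped rest n

variable {Δ : SID ar arP}

theorem stdGraph_src (T : PTree Δ.rules) (args : List TVar) (p : List ℕ) :
    (stdGraph T args p).src = args := by
  cases T <;> rfl

theorem addrs_ruleBase (ρ : SIDRule ar arP) (args : List TVar) (p : List ℕ) :
    ∀ x ∈ PreEdge.addrs (ruleBase ρ args p).edges, x.1 = p := by
  intro x hx
  obtain ⟨i, -, rfl⟩ := QFormula.addrs_relEdges_subset _ _ _ hx
  rfl

theorem addrs_ruleBase_disjoint (ρ : SIDRule ar arP) (args : List TVar) (p : List ℕ) (c : ℕ) :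
    Disjoint (Below (c :: p)) (PreEdge.addrs (ruleBase ρ args p).edges) := by
  refine Set.disjoint_left.2 fun x hx hx' => ?_
  have h : x = (p, x.2) := Prod.ext (addrs_ruleBase ρ args p x hx') rfl
  exact mk_notMem_below_cons c p x.2 (h ▸ hx)

theorem addrs_stdGraph (T : PTree Δ.rules) (args : List TVar) (p : List ℕ) :
    PreEdge.addrs (stdGraph T args p).edges ⊆ Below p := by
  induction T generalizing args p with
  | leaf => simp [stdGraph, PreEdge.addrs]
  | edge ρ k sub rest ihs ihr =>
    simp only [stdGraph, PreGraph.par, PreGraph.plug, PreEdge.addrs_union, PreEdge.addrs_iUnion,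
      Set.union_subset_iff, Set.iUnion_subset_iff]
    refine ⟨⟨fun x hx => ?_, fun i => (ihs i _ _).trans (below_cons_subset _ _)⟩,
      (ihr _ _).trans (below_cons_subset _ _)⟩
    rw [Below, Set.mem_ofPred_eq, addrs_ruleBase ρ.1 args p x hx]

theorem describes_charFormAux (T : PTree Δ.rules) (args : List TVar) (p : List ℕ) :
    (charFormAux T args p).Describes (stdGraph T args p).edges := by
  induction T generalizing args p with
  | leaf => exact QFormula.describes_emp
  | edge ρ k sub rest ihs ihr =>
    simp only [charFormAux, stdGraph, PreGraph.par, PreGraph.plug, Set.union_assoc]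
    refine (QFormula.describes_subst _ (fun i => (p, i)) (fun i j h => by simpa using h) _).star
      ((QFormula.describes_bigStar _ _ (fun i => ihs i _ _) ?_).star (ihr _ _) ?_) ?_
    · intro i j hij
      refine (below_cons_disjoint ?_ p).mono (addrs_stdGraph _ _ _) (addrs_stdGraph _ _ _)
      simpa [Fin.ext_iff] using hij
    · rw [PreEdge.addrs_iUnion, Set.disjoint_iUnion_left]
      exact fun i => (below_cons_disjoint (by simp) p).mono (addrs_stdGraph _ _ _)
        (addrs_stdGraph _ _ _)
    · rw [PreEdge.addrs_union, PreEdge.addrs_iUnion, Set.disjoint_union_right,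
        Set.disjoint_iUnion_right]
      exact ⟨fun i => ((addrs_ruleBase_disjoint ρ.1 args p _).mono_left (addrs_stdGraph _ _ _)).symm,
        ((addrs_ruleBase_disjoint ρ.1 args p _).mono_left (addrs_stdGraph _ _ _)).symm⟩

theorem ruleBase_wf (ρ : SIDRule ar arP) {args : List TVar} {p : List ℕ}
    (h : FreshArgs args p (arP ρ.head)) : (ruleBase ρ args p).WF ar where
  verts_finite := Set.finite_range _
  edges_finite := by
    have : (ruleBase ρ args p).edges ⊆ ⋃ i : Fin ρ.psi.atoms.length,
        {e | ∃ r xs, ρ.psi.atoms[(i : ℕ)]? = some (.rel r xs) ∧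
          e = ⟨(p, i), r, List.ofFn fun t => inst args p (xs t)⟩} := by
      rintro _ ⟨i, r, xs, hi, rfl⟩
      exact Set.mem_iUnion.2 ⟨⟨i, (List.getElem?_eq_some_iff.1 hi).1⟩, r, xs, hi, rfl⟩
    refine Set.Finite.subset (Set.finite_iUnion fun i => Set.Subsingleton.finite ?_) this
    rintro _ ⟨r, xs, hi, rfl⟩ _ ⟨r', xs', hi', rfl⟩
    rw [hi] at hi'
    cases hi'
    rfl
  addr_inj := by
    rintro _ ⟨i, r, xs, hi, rfl⟩ _ ⟨i', r', xs', hi', rfl⟩ hii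
    obtain rfl : i = i' := by simpa using hii
    rw [hi] at hi'
    cases hi'
    rfl
  att_length := by
    rintro _ ⟨i, r, xs, hi, rfl⟩
    simp
  att_mem := by
    rintro _ ⟨i, r, xs, hi, rfl⟩ x hx
    obtain ⟨t, rfl⟩ := List.mem_ofFn.1 hx
    exact ⟨_, rfl⟩
  src_mem := by
    intro x hx
    rw [ruleBase, ← h.map_inst (m := ρ.m)] at hx
    obtain ⟨t, rfl⟩ := List.mem_ofFn.1 hx
    exact ⟨_, rfl⟩
  src_nodup := h.nodup

theorem mem_ruleBase_verts {ρ : SIDRule ar arP} {args : List TVar} {p : List ℕ}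
    (h : FreshArgs args p (arP ρ.head)) {x : TVar} (hx : x ∈ (ruleBase ρ args p).verts) :
    x ∈ args ∨ ∃ j, x = (p, j) := by
  obtain ⟨i | j, rfl⟩ := hx
  · exact Or.inl (h.inst_inl_mem i)
  · exact Or.inr ⟨j, rfl⟩

theorem ruleBase_verts_notMem_below {ρ : SIDRule ar arP} {args : List TVar} {p : List ℕ}
    (h : FreshArgs args p (arP ρ.head)) {x : TVar} (hx : x ∈ (ruleBase ρ args p).verts) (c : ℕ) :
    x ∉ Below (c :: p) := by
  rcases mem_ruleBase_verts h hx with hx | ⟨j, rfl⟩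
  · exact (h.cons c).notMem x hx
  · exact mk_notMem_below_cons c p j

theorem callArgs_subset (ρ : SIDRule ar arP) (args : List TVar) (p : List ℕ) (i : ℕ) :
    ∀ x ∈ callArgs ρ args p i, x ∈ (ruleBase ρ args p).verts := by
  intro x hx
  rw [callArgs] at hx
  rcases hc : ρ.calls[i]? with _ | c
  · simp [hc] at hx
  · simp only [hc, Option.map_some, Option.getD_some, List.mem_ofFn] at hx
    obtain ⟨j, rfl⟩ := hx
    exact ⟨_, rfl⟩

theorem callArgs_eq {ρ : SIDRule ar arP} {i : ℕ} {c : PredAtom arP (Fin (arP ρ.head) ⊕ Fin ρ.m)}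
    (hc : ρ.calls[i]? = some c) (args : List TVar) (p : List ℕ) :
    callArgs ρ args p i = List.ofFn fun j => inst args p (c.args j) := by
  simp [callArgs, hc]

theorem FreshArgs.call {ρ : SIDRule ar arP} {args : List TVar} {p : List ℕ}
    (h : FreshArgs args p (arP ρ.head)) (heq : ρ.EqualityFree) {i : ℕ}
    {c : PredAtom arP (Fin (arP ρ.head) ⊕ Fin ρ.m)} (hc : ρ.calls[i]? = some c) :
    FreshArgs (callArgs ρ args p i) ((i + 1) :: p) (arP c.pred) where
  nodup := by
    rw [callArgs_eq hc]
    exact List.nodup_ofFn.2 (h.inst_injective.comp (heq.2 c (List.mem_of_getElem? hc)))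
  length := by simp [callArgs_eq hc]
  notMem := fun x hx => ruleBase_verts_notMem_below h (callArgs_subset ρ args p i x hx) _

theorem stdGraph_pluggable {ρ : SIDRule ar arP} {k : ℕ} {args : List TVar} {p : List ℕ}
    (h : FreshArgs args p (arP ρ.head)) (sub : Fin k → PTree Δ.rules)
    (hv : ∀ i : Fin k, (stdGraph (sub i) (callArgs ρ args p i) ((i + 1) :: p)).verts ⊆
      {x | x ∈ callArgs ρ args p i} ∪ Below ((i + 1) :: p)) :
    (ruleBase ρ args p).Pluggable
      fun i : Fin k => stdGraph (sub i) (callArgs ρ args p i) ((i + 1) :: p) where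
  src_mem i x hx := by
    rw [stdGraph_src] at hx
    exact callArgs_subset ρ args p i x hx
  mem_src i x hx hx' := by
    rw [stdGraph_src]
    exact (hv i hx).resolve_right (ruleBase_verts_notMem_below h hx' _)
  verts i j hij x hx hx' := by
    rcases hv i hx with hx | hx
    · exact callArgs_subset ρ args p i x hx
    rcases hv j hx' with hx' | hx'
    · exact callArgs_subset ρ args p j x hx'
    refine (Set.disjoint_left.1 (below_cons_disjoint ?_ p) hx hx').elim
    simpa [Fin.ext_iff] using hij
  base_edges i := (addrs_ruleBase_disjoint ρ args p _).mono_left (addrs_stdGraph _ _ _)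
  edges i j hij := by
    refine (below_cons_disjoint ?_ p).mono (addrs_stdGraph _ _ _) (addrs_stdGraph _ _ _)
    simpa [Fin.ext_iff] using hij

theorem addrs_plug_disjoint {k : ℕ} (ρ : SIDRule ar arP) (sub : Fin k → PTree Δ.rules)
    (rest : PTree Δ.rules) (args : List TVar) (p : List ℕ) :
    Disjoint (PreEdge.addrs ((ruleBase ρ args p).plug fun i : Fin k =>
        stdGraph (sub i) (callArgs ρ args p i) ((i + 1) :: p)).edges)
      (PreEdge.addrs (stdGraph rest args (0 :: p)).edges) := by
  simp only [PreGraph.plug, PreEdge.addrs_union, PreEdge.addrs_iUnion, Set.disjoint_union_left,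
    Set.disjoint_iUnion_left]
  exact ⟨((addrs_ruleBase_disjoint ρ args p _).mono_left (addrs_stdGraph _ _ _)).symm,
    fun i => (below_cons_disjoint (by simp) p).mono (addrs_stdGraph _ _ _) (addrs_stdGraph _ _ _)⟩

/-- The calls of an edge of a well-typed tree and the subtrees that unfold them. -/
theorem WellTyped.call {ρ : Δ.rules} {k : ℕ} {sub : Fin k → PTree Δ.rules} {rest : PTree Δ.rules}
    {n : ℕ} (hT : WellTyped (PTree.edge ρ k sub rest) n) (i : Fin k) :
    ∃ c, ρ.1.calls[(i : ℕ)]? = some c ∧ WellTyped (sub i) (arP c.pred) := by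
  obtain ⟨-, -, hk, hsub, -⟩ := hT
  have hi : (i : ℕ) < ρ.1.calls.length := hk ▸ i.2
  exact ⟨_, List.getElem?_eq_getElem hi, (hsub i).2 _ (List.getElem?_eq_getElem hi)⟩

theorem stdGraph_wf_and_verts (heq : Δ.EqualityFree) (T : PTree Δ.rules) {n : ℕ}
    (hT : WellTyped T n) {args : List TVar} {p : List ℕ} (h : FreshArgs args p n) :
    (stdGraph T args p).WF ar ∧ (stdGraph T args p).verts ⊆ {x | x ∈ args} ∪ Below p := by
  induction T generalizing args p n with
  | leaf =>
    refine ⟨⟨?_, ?_, ?_, ?_, ?_, ?_, h.nodup⟩, Set.subset_union_left⟩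
    · exact List.finite_toSet args
    all_goals simp [stdGraph]
  | edge ρ k sub rest ihs ihr =>
    have hT' := hT
    obtain ⟨-, rfl, -, -, hrest⟩ := hT'
    have hsub : ∀ i : Fin k,
        (stdGraph (sub i) (callArgs ρ.1 args p i) ((i + 1) :: p)).WF ar ∧
        (stdGraph (sub i) (callArgs ρ.1 args p i) ((i + 1) :: p)).verts ⊆
          {x | x ∈ callArgs ρ.1 args p i} ∪ Below ((i + 1) :: p) := fun i => by
      obtain ⟨c, hc, hwt⟩ := hT.call i
      exact ihs i hwt (h.call (heq ρ.1 ρ.2) hc)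
    have hr := ihr hrest (h.cons 0)
    have hp := stdGraph_pluggable h sub fun i => (hsub i).2
    refine ⟨PreGraph.par_wf (hp.wf (ruleBase_wf ρ.1 h) fun i => (hsub i).1) hr.1
      (addrs_plug_disjoint ρ.1 sub rest args p), ?_⟩
    have hbase : (ruleBase ρ.1 args p).verts ⊆ {x | x ∈ args} ∪ Below p := by
      intro x hx
      rcases mem_ruleBase_verts h hx with hx | ⟨j, rfl⟩
      · exact Or.inl hx
      · exact Or.inr (mk_mem_below p j)
    simp only [stdGraph, PreGraph.par, PreGraph.plug]
    refine Set.union_subset (Set.union_subset hbase (Set.iUnion_subset fun i x hx => ?_))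
      (hr.2.trans (Set.union_subset_union_right _ (below_cons_subset _ _)))
    rcases (hsub i).2 hx with hx | hx
    · exact hbase (callArgs_subset ρ.1 args p i x hx)
    · exact Or.inr (below_cons_subset _ _ hx)

theorem stdGraph_mem_args (heq : Δ.EqualityFree) {ρ : Δ.rules} {k : ℕ}
    {sub : Fin k → PTree Δ.rules} {rest : PTree Δ.rules} {n : ℕ}
    (hT : WellTyped (PTree.edge ρ k sub rest) n) {args : List TVar} {p : List ℕ}
    (h : FreshArgs args p n) :
    ∀ x ∈ ((ruleBase ρ.1 args p).plug fun i : Fin k =>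
      stdGraph (sub i) (callArgs ρ.1 args p i) ((i + 1) :: p)).verts,
      x ∈ (stdGraph rest args (0 :: p)).verts → x ∈ args := by
  intro x hx hx'
  have hT' := hT
  obtain ⟨-, rfl, -, -, hrest⟩ := hT'
  refine ((stdGraph_wf_and_verts heq rest hrest (h.cons 0)).2 hx').resolve_right fun hb => ?_
  rcases hx with hx | hx
  · exact ruleBase_verts_notMem_below h hx 0 hb
  · obtain ⟨i, hi⟩ := Set.mem_iUnion.1 hx
    obtain ⟨c, hc, hwt⟩ := hT.call i
    rcases (stdGraph_wf_and_verts heq _ hwt (h.call (heq ρ.1 ρ.2) hc)).2 hi with hx | hx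
    · exact ruleBase_verts_notMem_below h (callArgs_subset ρ.1 args p i x hx) 0 hb
    · exact Set.disjoint_left.1 (below_cons_disjoint (by simp) p) hx hb

/-- Every variable of a regular rule occurs in a relation atom or in a predicate atom. -/
theorem _root_.SIDRule.RegularBody.occurs {ρ : SIDRule ar arP} (hρ : ρ.RegularBody)
    (z : Fin (arP ρ.head) ⊕ Fin ρ.m) :
    (∃ a ∈ ρ.psi.atoms, a.isRel = true ∧ z ∈ a.vars) ∨ ∃ c ∈ ρ.calls, z ∈ Set.range c.args := by
  obtain ⟨hbody, hpath⟩ := hρ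
  by_cases hz : ∃ z', z ≠ z'
  · obtain ⟨z', hz'⟩ := hz
    have hadj : ∃ t, ρ.Adj z t := by
      cases hpath z z' hz' with
      | single _ _ h => exact ⟨_, h⟩
      | cons _ c _ h => exact ⟨_, h⟩
    obtain ⟨t, a, ha, hr, hza, -⟩ := hadj
    exact Or.inl ⟨a, ha, hr, hza⟩
  · push Not at hz
    rcases hbody with ⟨-, -, a, ha, hall⟩ | ⟨hne, hrel, hcall⟩
    · have : a ∈ ρ.psi.atoms.filter Atom.isRel := by simp [ha]
      rw [List.mem_filter] at this
      exact Or.inl ⟨a, this.1, this.2, hall z⟩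
    · rcases hne with ⟨a, ha, hr⟩ | hne
      · obtain ⟨j, hj⟩ := hrel a ha hr
        exact Or.inl ⟨a, ha, hr, hz _ ▸ hj⟩
      · obtain ⟨c, hc⟩ := List.exists_mem_of_ne_nil _ hne
        obtain ⟨j, hj⟩ := hcall c hc
        exact Or.inr ⟨c, hc, hz _ ▸ hj⟩

theorem stdGraph_verts_covered (hprod : ∀ ρ ∈ Δ.rules, ¬ ρ.Unproductive → ρ.RegularBody)
    (T : PTree Δ.rules) (hleaf : T ≠ PTree.leaf) {n : ℕ} (hT : WellTyped T n) {args : List TVar}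
    {p : List ℕ} (h : args.length = n) :
    ∀ x, x ∈ (stdGraph T args p).verts ∨ x ∈ args →
      x ∈ PreEdge.attVerts (stdGraph T args p).edges := by
  induction T generalizing args p n with
  | leaf => exact (hleaf rfl).elim
  | edge ρ k sub rest ihs ihr =>
    have hT' := hT
    obtain ⟨hun, rfl, hk, hsubs, hrest⟩ := hT'
    have hsub : ∀ i : Fin k, ∀ x,
        x ∈ (stdGraph (sub i) (callArgs ρ.1 args p i) ((i + 1) :: p)).verts ∨
          x ∈ callArgs ρ.1 args p i →
        x ∈ PreEdge.attVerts
          (stdGraph (sub i) (callArgs ρ.1 args p i) ((i + 1) :: p)).edges := fun i => by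
      obtain ⟨c, hc, hwt⟩ := hT.call i
      exact ihs i (hsubs i).1 hwt (args := callArgs ρ.1 args p i) (p := (i + 1) :: p)
        (by simp [callArgs_eq hc])
    have hin : ∀ i : Fin k, ∀ x, x ∈ PreEdge.attVerts
        (stdGraph (sub i) (callArgs ρ.1 args p i) ((i + 1) :: p)).edges →
        x ∈ PreEdge.attVerts (stdGraph (PTree.edge ρ k sub rest) args p).edges := by
      rintro i x ⟨e, he, hx⟩
      exact ⟨e, Or.inl (Or.inr (Set.mem_iUnion.2 ⟨i, he⟩)), hx⟩
    have hbase : ∀ x ∈ (ruleBase ρ.1 args p).verts,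
        x ∈ PreEdge.attVerts (stdGraph (PTree.edge ρ k sub rest) args p).edges := by
      rintro _ ⟨z, rfl⟩
      rcases (hprod ρ.1 ρ.2 hun).occurs z with ⟨a, ha, hr, hz⟩ | ⟨c, hc, t, rfl⟩
      · cases a with
        | eq x y => simp [Atom.isRel] at hr
        | neq x y => simp [Atom.isRel] at hr
        | rel r xs =>
          obtain ⟨t, rfl⟩ := hz
          obtain ⟨i, hi⟩ := List.mem_iff_getElem?.1 ha
          exact ⟨_, Or.inl (Or.inl ⟨i, r, xs, hi, rfl⟩), List.mem_ofFn.2 ⟨t, rfl⟩⟩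
      · obtain ⟨i, hi⟩ := List.mem_iff_getElem?.1 hc
        have hik : i < k := hk ▸ (List.getElem?_eq_some_iff.1 hi).1
        refine hin ⟨i, hik⟩ _ (hsub ⟨i, hik⟩ _ (Or.inr ?_))
        rw [callArgs_eq hi]
        exact List.mem_ofFn.2 ⟨t, rfl⟩
    have hargs : ∀ x ∈ args, x ∈ (ruleBase ρ.1 args p).verts := by
      intro x hx
      obtain ⟨i, hi, rfl⟩ := List.getElem_of_mem hx
      refine ⟨.inl ⟨i, h ▸ hi⟩, ?_⟩
      rw [inst, List.getD_eq_getElem _ _ hi]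
    rintro x (((hx | hx) | hx) | hx)
    · exact hbase x hx
    · obtain ⟨i, hi⟩ := Set.mem_iUnion.1 hx
      exact hin i x (hsub i x (Or.inl hi))
    · by_cases hl : rest = PTree.leaf
      · subst hl
        exact hbase x (hargs x hx)
      · obtain ⟨e, he, hx⟩ := ihr hl hrest h (p := 0 :: p) x (Or.inl hx)
        exact ⟨e, Or.inr he, hx⟩
    · exact hbase x (hargs x hx)

theorem charFormAux_atoms (heq : Δ.EqualityFree) (T : PTree Δ.rules)
    (args : List TVar) (p : List ℕ) {a : Atom ar TVar} (ha : a ∈ (charFormAux T args p).atoms) :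
    (∀ x y, a ≠ .eq x y) ∧ ∀ x ∈ a.vars, x ∈ (stdGraph T args p).verts := by
  induction T generalizing args p with
  | leaf => simp [charFormAux, QFormula.atoms] at ha
  | edge ρ k sub rest ihs ihr =>
    simp only [charFormAux, QFormula.atoms, List.mem_append, QFormula.mem_atoms_bigStar,
      List.mem_ofFn, QFormula.atoms_subst, List.mem_map] at ha
    rcases ha with ⟨b, hb, rfl⟩ | ⟨_, ⟨i, rfl⟩, ha⟩ | ha
    · cases b with
      | eq x y => exact ((heq ρ.1 ρ.2).1 x y hb).elim
      | neq x y =>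
        refine ⟨by simp [Atom.subst], ?_⟩
        rintro _ (rfl | rfl)
        · exact Or.inl (Or.inl ⟨_, rfl⟩)
        · exact Or.inl (Or.inl ⟨_, rfl⟩)
      | rel r xs =>
        refine ⟨by simp [Atom.subst], ?_⟩
        rintro _ ⟨t, rfl⟩
        exact Or.inl (Or.inl ⟨_, rfl⟩)
    · obtain ⟨h1, h2⟩ := ihs i _ _ ha
      exact ⟨h1, fun x hx => Or.inl (Or.inr (Set.mem_iUnion.2 ⟨i, h2 x hx⟩))⟩
    · obtain ⟨h1, h2⟩ := ihr _ _ ha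
      exact ⟨h1, fun x hx => Or.inr (h2 x hx)⟩

end SID

/-! ## Relabelling of derivation trees and parse trees -/

namespace PTree

variable {R S : Type*}

theorem map_join (f : R → S) (t t' : PTree R) : (t.join t').map f = (t.map f).join (t'.map f) := by
  induction t with
  | leaf => rfl
  | edge ρ k sub rest _ ih => simp only [join, map, ih]

theorem map_foldr_join (f : R → S) (l : List (PTree R)) :
    (l.foldr join leaf).map f = (l.map (map f)).foldr join leaf := by
  induction l with
  | nil => rfl
  | cons t l ih => simp only [List.foldr_cons, List.map_cons, map_join, ih]

theorem map_map {S' : Type*} (f : R → S) (g : S → S') (t : PTree R) :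
    (t.map f).map g = t.map (g ∘ f) := by
  induction t with
  | leaf => rfl
  | edge ρ k sub rest ihs ih => simp only [map, ih, ihs, Function.comp]

theorem map_id (t : PTree R) : t.map id = t := by
  induction t with
  | leaf => rfl
  | edge ρ k sub rest ihs ih => simp only [map, ih, ihs, id]

theorem Iso.map {t t' : PTree R} (f : R → S) (h : t.Iso t') : (t.map f).Iso (t'.map f) := by
  induction h with
  | leaf => exact .leaf
  | edge ρ k sub sub' rest rest' _ _ ihs ih => exact .edge _ _ _ _ _ _ ihs ih
  | swap => exact .swap ..
  | trans _ _ _ _ _ ih ih' => exact .trans _ _ _ ih ih'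

theorem Iso.ne_leaf {t t' : PTree R} (h : t.Iso t') (ht : t ≠ PTree.leaf) :
    t' ≠ PTree.leaf := by
  induction h with
  | leaf => exact ht
  | edge => simp
  | swap => simp
  | trans _ _ _ _ _ ih ih' => exact ih' (ih ht)

theorem join_ne_leaf {t : PTree R} (ht : t ≠ leaf) (t' : PTree R) : t.join t' ≠ leaf := by
  cases t with
  | leaf => exact (ht rfl).elim
  | edge => simp [join]

end PTree

namespace DTree

variable {R S N : Type*}

/-- Relabelling of the edges. -/
def map (f : R → S) : DTree R → DTree S
  | node ρ k sub => node (f ρ) k fun i => (sub i).map f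

theorem Derives.map {f : R → S} {lhs : S → N} {rhs : S → List N} {U : DTree R} {a : N}
    (h : U.Derives (lhs ∘ f) (rhs ∘ f) a) : (U.map f).Derives lhs rhs a := by
  induction U generalizing a with
  | node ρ k sub ih =>
    obtain ⟨h1, h2, h3⟩ := h
    exact ⟨h1, h2, fun i => ih i (h3 i)⟩

theorem contract_map (f : R → S) (unprod : S → Prop) (U : DTree R) :
    (U.map f).contract unprod = (U.contract (unprod ∘ f)).map f := by
  induction U with
  | node ρ k sub ih =>
    simp only [map, contract, Function.comp_apply, ih]
    split_ifs
    · rw [PTree.map_foldr_join, List.map_ofFn]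
      rfl
    · rfl

end DTree

theorem map_mem_parseTrees {R S N : Type*} (f : R → S) {lhs : S → N} {rhs : S → List N}
    {unprod : S → Prop} {a : N} {T : PTree R}
    (hT : T ∈ parseTrees (lhs ∘ f) (rhs ∘ f) (unprod ∘ f) a) :
    T.map f ∈ parseTrees lhs rhs unprod a := by
  obtain ⟨U, hU, hiso⟩ := hT
  refine ⟨U.map f, hU.map, ?_⟩
  rw [DTree.contract_map]
  exact hiso.map f

theorem mem_parseTrees_iff_map {R S N : Type*} (γ : R ≃ S) {lhs : S → N} {rhs : S → List N}
    {unprod : S → Prop} {a : N} (T : PTree R) :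
    T ∈ parseTrees (lhs ∘ γ) (rhs ∘ γ) (unprod ∘ γ) a ↔ T.map γ ∈ parseTrees lhs rhs unprod a := by
  refine ⟨map_mem_parseTrees γ, fun h => ?_⟩
  have h' : T.map γ ∈ parseTrees ((lhs ∘ γ) ∘ γ.symm) ((rhs ∘ γ) ∘ γ.symm)
      ((unprod ∘ γ) ∘ γ.symm) a := by
    simpa only [Function.comp_assoc, Equiv.self_comp_symm, Function.comp_id] using h
  have := map_mem_parseTrees γ.symm h'
  rwa [PTree.map_map, Equiv.symm_comp_self, PTree.map_id] at this

/-! ## Parse trees are well typed -/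

namespace SID

variable {L : Type u} {ar : L → ℕ} {P : Type v} {arP : P → ℕ} {Δ : SID ar arP}

theorem WellTyped.join {t t' : PTree Δ.rules} {n : ℕ} (h : WellTyped t n) (h' : WellTyped t' n) :
    WellTyped (t.join t') n := by
  induction t with
  | leaf => exact h'
  | edge ρ k sub rest _ ih =>
    obtain ⟨h1, h2, h3, h4, h5⟩ := h
    exact ⟨h1, h2, h3, h4, ih h5⟩

theorem WellTyped.foldr_join {l : List (PTree Δ.rules)} {n : ℕ} (h : ∀ t ∈ l, WellTyped t n) :
    WellTyped (l.foldr PTree.join PTree.leaf) n := by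
  induction l with
  | nil => trivial
  | cons t l ih => exact (h t (by simp)).join (ih fun t' ht' => h t' (by simp [ht']))

theorem WellTyped.iso {t t' : PTree Δ.rules} (hiso : t.Iso t') {n : ℕ} (h : WellTyped t n) :
    WellTyped t' n := by
  induction hiso generalizing n with
  | leaf => trivial
  | edge ρ k sub sub' rest rest' hs _ ihs ih =>
    obtain ⟨h1, h2, h3, h4, h5⟩ := h
    exact ⟨h1, h2, h3, fun i => ⟨(hs i).ne_leaf (h4 i).1, fun c hc => ihs i ((h4 i).2 c hc)⟩,
      ih h5⟩
  | swap =>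
    obtain ⟨h1, h2, h3, h4, h1', h2', h3', h4', h5⟩ := h
    exact ⟨h1', h2', h3', h4', h1, h2, h3, h4, h5⟩
  | trans _ _ _ _ _ ih ih' => exact ih' (ih h)

theorem _root_.SIDRule.PassesParams.arity {ρ : SIDRule ar arP}
    {c : PredAtom arP (Fin (arP ρ.head) ⊕ Fin ρ.m)} (h : ρ.PassesParams c) :
    arP c.pred = arP ρ.head := by
  simpa using congrArg List.length h

theorem wellTyped_contract (hun : ∀ ρ ∈ Δ.rules, ρ.Unproductive → ρ.calls ≠ [])
    (U : DTree Δ.rules) {a : P}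
    (hU : U.Derives (fun ρ : Δ.rules => ρ.1.head)
      (fun ρ : Δ.rules => ρ.1.calls.map PredAtom.pred) a) :
    WellTyped (U.contract fun ρ : Δ.rules => ρ.1.Unproductive) (arP a) ∧
      (U.contract fun ρ : Δ.rules => ρ.1.Unproductive) ≠ PTree.leaf := by
  induction U generalizing a with
  | node ρ k sub ih =>
    obtain ⟨rfl, hk, hsub⟩ := hU
    have hk' : ρ.1.calls.length = k := by simpa using hk
    subst hk'
    have hs : ∀ i : Fin ρ.1.calls.length, _ ∧ _ := fun i => ih i (hsub i)
    simp only [List.get_eq_getElem, Fin.val_cast, List.getElem_map] at hs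
    rw [DTree.contract]
    split_ifs with hρ
    · constructor
      · refine WellTyped.foldr_join fun t ht => ?_
        obtain ⟨i, rfl⟩ := List.mem_ofFn.1 ht
        rw [← (hρ.2.2 _ (List.getElem_mem i.2)).arity]
        exact (hs i).1
      · have hpos : ρ.1.calls.length ≠ 0 := fun h => hun ρ.1 ρ.2 hρ (List.length_eq_zero_iff.1 h)
        have key : ∀ l : List (PTree Δ.rules), l ≠ [] → (∀ t ∈ l, t ≠ PTree.leaf) →
            l.foldr PTree.join PTree.leaf ≠ PTree.leaf := by
          intro l hl hne
          cases l with
          | nil => exact (hl rfl).elim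
          | cons t l => exact PTree.join_ne_leaf (hne t (by simp)) _
        refine key _ (fun h => hpos (by simpa using congrArg List.length h)) fun t ht => ?_
        obtain ⟨i, rfl⟩ := List.mem_ofFn.1 ht
        exact (hs i).2
    · refine ⟨⟨hρ, rfl, rfl, fun i => ⟨(hs i).2, fun c hc => ?_⟩, trivial⟩, by simp⟩
      obtain ⟨hi, rfl⟩ := List.getElem?_eq_some_iff.1 hc
      exact (hs i).1

theorem wellTyped_of_mem_parseTrees (hun : ∀ ρ ∈ Δ.rules, ρ.Unproductive → ρ.calls ≠ [])
    {A : P} {T : PTree Δ.rules} (hT : T ∈ Δ.parseTrees A) :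
    WellTyped T (arP A) ∧ T ≠ PTree.leaf := by
  obtain ⟨U, hU, hiso⟩ := hT
  obtain ⟨h1, h2⟩ := wellTyped_contract hun U hU
  exact ⟨h1.iso hiso, hiso.ne_leaf h2⟩

end SID

theorem List.not_index_lt_of_filter_eq_singleton {α : Type*} {p : α → Bool} {l : List α} {a : α}
    (h : l.filter p = [a]) {i j : ℕ} (hi : i < l.length) (hj : j < l.length)
    (hpi : p l[i] = true) (hpj : p l[j] = true) : ¬ i < j := by
  intro hlt
  have hs : List.Sublist [l[i], l[j]] l := by
    refine List.sublist_iff_exists_fin_orderEmbedding_get_eq.2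
      ⟨OrderEmbedding.ofStrictMono ![⟨i, hi⟩, ⟨j, hj⟩] ?_, ?_⟩
    · intro a b hab
      fin_cases a <;> fin_cases b <;> simp_all
    · intro a
      fin_cases a <;> rfl
  have := (hs.filter p).length_le
  simp [hpi, hpj, h] at this

theorem List.index_eq_of_filter_eq_singleton {α : Type*} {p : α → Bool} {l : List α} {a : α}
    (h : l.filter p = [a]) {i j : ℕ} (hi : i < l.length) (hj : j < l.length)
    (hpi : p l[i] = true) (hpj : p l[j] = true) : i = j :=
  le_antisymm (not_lt.1 (not_index_lt_of_filter_eq_singleton h hj hi hpj hpi))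
    (not_lt.1 (not_index_lt_of_filter_eq_singleton h hi hj hpi hpj))

/-! ## The grammar of a regular SID -/

/-- The vertex that represents a variable of a rule. -/
def ruleVarName {n m : ℕ} : Fin n ⊕ Fin m → ℕ
  | .inl i => 2 * i
  | .inr j => 2 * j + 1

theorem ruleVarName_injective {n m : ℕ} :
    Function.Injective (ruleVarName : Fin n ⊕ Fin m → ℕ) := by
  rintro (i | i) (j | j) h <;> simp only [ruleVarName] at h
  · rw [Fin.ext (by omega : (i : ℕ) = j)]
  · omega
  · omega
  · rw [Fin.ext (by omega : (i : ℕ) = j)]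

namespace SIDRule

variable {L : Type u} {ar : L → ℕ} {P : Type v} {arP : P → ℕ}

/-- The terminal edges of the graph of a rule. The number `d` is stored in their identities. -/
def termEdges (ρ : SIDRule ar arP) (d : ℕ) : Set (HEdge (L ⊕ P)) :=
  {e | ∃ i r xs, ρ.psi.atoms[i]? = some (.rel r xs) ∧
    e = ⟨Nat.pair d (2 * i), .inl r, List.ofFn fun t => ruleVarName (xs t)⟩}

/-- The nonterminal edges of the graph of a rule. -/
def callEdges (ρ : SIDRule ar arP) (d : ℕ) : Set (HEdge (L ⊕ P)) :=
  {e | ∃ i c, ρ.calls[i]? = some c ∧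
    e = ⟨Nat.pair d (2 * i + 1), .inr c.pred, List.ofFn fun t => ruleVarName (c.args t)⟩}

/-- The nonterminal edges of the graph of a rule, in the order of the predicate atoms. -/
def callList (ρ : SIDRule ar arP) (d : ℕ) : List (HEdge P) :=
  ρ.calls.mapIdx fun i c =>
    ⟨Nat.pair d (2 * i + 1), c.pred, List.ofFn fun t => ruleVarName (c.args t)⟩

/-- The graph of a rule: its vertices are the variables and its edges the atoms of the rule. -/
def ruleGraph (ρ : SIDRule ar arP) (d : ℕ) : CGraph (Sum.elim ar arP) where
  verts := Set.range (ruleVarName : Fin (arP ρ.head) ⊕ Fin ρ.m → ℕ)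
  edges := ρ.termEdges d ∪ ρ.callEdges d
  src := List.ofFn fun i : Fin (arP ρ.head) => ruleVarName (m := ρ.m) (.inl i)
  verts_finite := Set.finite_range _
  edges_finite := by
    refine Set.Finite.union ?_ ?_
    · have : ρ.termEdges d ⊆ ⋃ i : Fin ρ.psi.atoms.length,
          {e | ∃ r xs, ρ.psi.atoms[(i : ℕ)]? = some (.rel r xs) ∧
            e = ⟨Nat.pair d (2 * i), .inl r, List.ofFn fun t => ruleVarName (xs t)⟩} := by
        rintro _ ⟨i, r, xs, hi, rfl⟩
        exact Set.mem_iUnion.2 ⟨⟨i, (List.getElem?_eq_some_iff.1 hi).1⟩, r, xs, hi, rfl⟩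
      refine Set.Finite.subset (Set.finite_iUnion fun i => Set.Subsingleton.finite ?_) this
      rintro _ ⟨r, xs, hi, rfl⟩ _ ⟨r', xs', hi', rfl⟩
      rw [hi] at hi'
      cases hi'
      rfl
    · have : ρ.callEdges d ⊆ ⋃ i : Fin ρ.calls.length,
          {⟨Nat.pair d (2 * i + 1), .inr ρ.calls[i].pred,
            List.ofFn fun t => ruleVarName (ρ.calls[i].args t)⟩} := by
        rintro _ ⟨i, c, hi, rfl⟩
        obtain ⟨hi', rfl⟩ := List.getElem?_eq_some_iff.1 hi
        exact Set.mem_iUnion.2 ⟨⟨i, hi'⟩, rfl⟩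
      exact (Set.finite_iUnion fun i => Set.finite_singleton _).subset this
  id_inj := by
    rintro _ (⟨i, r, xs, hi, rfl⟩ | ⟨i, c, hi, rfl⟩) _ (⟨j, r', xs', hj, rfl⟩ | ⟨j, c', hj, rfl⟩) h
      <;> simp only [Nat.pair_eq_pair, true_and] at h
    · obtain rfl : i = j := by omega
      rw [hi] at hj
      cases hj
      rfl
    · omega
    · omega
    · obtain rfl : i = j := by omega
      rw [hi] at hj
      cases hj
      rfl
  att_length := by
    rintro _ (⟨i, r, xs, hi, rfl⟩ | ⟨i, c, hi, rfl⟩) <;> simp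
  att_mem := by
    rintro _ (⟨i, r, xs, hi, rfl⟩ | ⟨i, c, hi, rfl⟩) x hx <;>
    · obtain ⟨t, rfl⟩ := List.mem_ofFn.1 hx
      exact ⟨_, rfl⟩
  src_mem := by
    intro x hx
    obtain ⟨t, rfl⟩ := List.mem_ofFn.1 hx
    exact ⟨_, rfl⟩
  src_nodup := List.nodup_ofFn.2 (ruleVarName_injective.comp Sum.inl_injective)

theorem ruleVarName_mem_src (ρ : SIDRule ar arP) (d : ℕ) (z : Fin (arP ρ.head) ⊕ Fin ρ.m) :
    ruleVarName z ∈ (ρ.ruleGraph d).src ↔ z.isLeft = true := by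
  constructor
  · intro h
    obtain ⟨i, hi⟩ := List.mem_ofFn.1 h
    rw [← ruleVarName_injective hi]
    rfl
  · rcases z with i | j
    · exact fun _ => List.mem_ofFn.2 ⟨i, rfl⟩
    · simp

theorem mem_termEdges_ruleGraph (ρ : SIDRule ar arP) (d : ℕ) (e : HEdge L) :
    e ∈ HRRhs.termEdges (ρ.ruleGraph d) ↔ ∃ i r xs, ρ.psi.atoms[i]? = some (.rel r xs) ∧
      e = ⟨Nat.pair d (2 * i), r, List.ofFn fun t => ruleVarName (xs t)⟩ := by
  obtain ⟨k, l, a⟩ := e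
  constructor
  · rintro (⟨i, r, xs, h, heq⟩ | ⟨i, c, -, heq⟩)
    · simp only [HEdge.mk.injEq, Sum.inl.injEq] at heq
      obtain ⟨rfl, rfl, rfl⟩ := heq
      exact ⟨i, _, xs, h, rfl⟩
    · simp at heq
  · rintro ⟨i, r, xs, h, heq⟩
    cases heq
    exact Or.inl ⟨i, _, xs, h, rfl⟩

theorem mem_callList (ρ : SIDRule ar arP) (d : ℕ) (e : HEdge P) :
    e ∈ ρ.callList d ↔ ∃ i c, ρ.calls[i]? = some c ∧
      e = ⟨Nat.pair d (2 * i + 1), c.pred, List.ofFn fun t => ruleVarName (c.args t)⟩ := by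
  rw [callList, List.mem_iff_getElem?]
  simp only [List.getElem?_mapIdx, Option.map_eq_some_iff]
  exact ⟨fun ⟨i, c, h, h'⟩ => ⟨i, c, h, h'.symm⟩, fun ⟨i, c, h, h'⟩ => ⟨i, c, h, h'.symm⟩⟩

theorem getElem_callList (ρ : SIDRule ar arP) (d i : ℕ) (h : i < (ρ.callList d).length)
    (h' : i < ρ.calls.length) : (ρ.callList d)[i] = ⟨Nat.pair d (2 * i + 1), ρ.calls[i].pred,
      List.ofFn fun t => ruleVarName (ρ.calls[i].args t)⟩ := by
  simp only [callList, List.getElem_mapIdx]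

theorem wellFormed_ruleGraph {ρ : SIDRule ar arP} (heq : ρ.EqualityFree) (d : ℕ) :
    (HRRhs.op (ρ.ruleGraph d) (ρ.callList d)).WellFormed (arP ρ.head) := by
  refine ⟨by simp [ruleGraph], ?_, ?_, ?_⟩
  · refine List.nodup_iff_injective_get.2 fun i j hij => ?_
    have hlen : (ρ.callList d).length = ρ.calls.length := List.length_mapIdx
    rw [List.get_eq_getElem, List.get_eq_getElem, getElem_callList ρ d i i.2 (hlen ▸ i.2),
      getElem_callList ρ d j j.2 (hlen ▸ j.2)] at hij
    have := (Nat.pair_eq_pair.1 (HEdge.mk.inj hij).1).2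
    exact Fin.ext (by omega)
  · intro e he
    obtain ⟨i, c, hc, rfl⟩ := (ρ.mem_callList d e).1 he
    exact List.nodup_ofFn.2 (ruleVarName_injective.comp (heq.2 c (List.mem_of_getElem? hc)))
  · intro e
    rw [mem_callList]
    obtain ⟨k, l, a⟩ := e
    constructor
    · rintro ⟨i, c, hc, h⟩
      cases h
      exact Or.inr ⟨i, c, hc, rfl⟩
    · rintro (⟨i, r, xs, -, h⟩ | ⟨i, c, hc, h⟩)
      · simp at h
      · simp only [HEdge.mk.injEq, Sum.inr.injEq] at h
        obtain ⟨rfl, rfl, rfl⟩ := h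
        exact ⟨i, c, hc, rfl⟩

theorem exists_rel_of_isRel {ρ : SIDRule ar arP} {a : Atom ar (Fin (arP ρ.head) ⊕ Fin ρ.m)}
    (ha : a ∈ ρ.psi.atoms) (hr : a.isRel = true) (d : ℕ) :
    ∃ e ∈ HRRhs.termEdges (ρ.ruleGraph d), ∀ z ∈ a.vars, ruleVarName z ∈ e.att := by
  cases a with
  | eq x y => simp [Atom.isRel] at hr
  | neq x y => simp [Atom.isRel] at hr
  | rel r xs =>
    obtain ⟨i, hi⟩ := List.mem_iff_getElem?.1 ha
    refine ⟨_, (mem_termEdges_ruleGraph ρ d _).2 ⟨i, r, xs, hi, rfl⟩, ?_⟩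
    rintro _ ⟨t, rfl⟩
    exact List.mem_ofFn.2 ⟨t, rfl⟩

theorem ruleGraph_edges_nonempty {ρ : SIDRule ar arP} (hρ : ρ.RegularBody) (d : ℕ) :
    (ρ.ruleGraph d).edges.Nonempty := by
  have hrel : (∃ a ∈ ρ.psi.atoms, a.isRel = true) ∨ ρ.calls ≠ [] := by
    rcases hρ.1 with ⟨-, -, a, ha, -⟩ | ⟨h, -⟩
    · have : a ∈ ρ.psi.atoms.filter Atom.isRel := by simp [ha]
      exact Or.inl ⟨a, List.mem_filter.1 this⟩
    · exact h
  rcases hrel with ⟨a, ha, hr⟩ | h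
  · obtain ⟨e, he, -⟩ := exists_rel_of_isRel ha hr d
    exact ⟨_, he⟩
  · obtain ⟨c, hc⟩ := List.exists_mem_of_ne_nil _ h
    obtain ⟨i, hi⟩ := List.mem_iff_getElem?.1 hc
    exact ⟨_, Or.inr ⟨i, c, hi, rfl⟩⟩

theorem regularOp_ruleGraph {ρ : SIDRule ar arP} (hρ : ρ.RegularBody) (d : ℕ) :
    HRRhs.RegularOp (ρ.ruleGraph d) := by
  have hne := ruleGraph_edges_nonempty hρ d
  obtain ⟨hbody, hpath⟩ := hρ
  constructor
  · rcases hbody with ⟨hm, hcalls, a, ha, hall⟩ | ⟨-, hrel, hcall⟩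
    · left
      have hamem : a ∈ ρ.psi.atoms.filter Atom.isRel := by simp [ha]
      obtain ⟨hmem, hr⟩ := List.mem_filter.1 hamem
      obtain ⟨e, he, hatt⟩ := exists_rel_of_isRel hmem hr d
      have huniq : ∀ e' ∈ HRRhs.termEdges (ρ.ruleGraph d), e' = e := by
        obtain ⟨i, r, xs, hi, rfl⟩ := (mem_termEdges_ruleGraph ρ d e).1 he
        intro e' he'
        obtain ⟨j, r', xs', hj, rfl⟩ := (mem_termEdges_ruleGraph ρ d _).1 he'
        have hij : i = j := by
          obtain ⟨hi', hi⟩ := List.getElem?_eq_some_iff.1 hi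
          obtain ⟨hj', hj⟩ := List.getElem?_eq_some_iff.1 hj
          exact List.index_eq_of_filter_eq_singleton ha hi' hj' (by rw [hi]; rfl) (by rw [hj]; rfl)
        subst hij
        rw [hi] at hj
        cases hj
        rfl
      refine ⟨e, ?_, ?_, ?_⟩
      · ext f
        constructor
        · rintro (⟨i, r, xs, hi, rfl⟩ | ⟨i, c, hc, rfl⟩)
          · rw [← huniq _ ((mem_termEdges_ruleGraph ρ d _).2 ⟨i, r, xs, hi, rfl⟩)]
            rfl
          · simp [hcalls] at hc
        · rintro rfl
          exact he
      · ext x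
        constructor
        · rintro ⟨i | j, rfl⟩
          · exact (ruleVarName_mem_src ρ d _).2 rfl
          · exact (Fin.elim0 (hm ▸ j))
        · exact (ρ.ruleGraph d).src_mem x
      · intro x hx
        obtain ⟨z, rfl⟩ := (ρ.ruleGraph d).src_mem x hx
        exact hatt z (hall z)
    · refine Or.inr ⟨hne, ?_⟩
      rintro _ (⟨i, r, xs, hi, rfl⟩ | ⟨i, c, hc, rfl⟩)
      · obtain ⟨j, t, ht⟩ := hrel _ (List.mem_of_getElem? hi) rfl
        refine ⟨_, List.mem_ofFn.2 ⟨t, rfl⟩, ?_⟩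
        rw [ruleVarName_mem_src, ht]
        simp
      · obtain ⟨j, t, ht⟩ := hcall _ (List.mem_of_getElem? hc)
        refine ⟨_, List.mem_ofFn.2 ⟨t, rfl⟩, ?_⟩
        rw [ruleVarName_mem_src, ht]
        simp
  · rintro _ ⟨z, rfl⟩ _ ⟨z', rfl⟩ hzz
    have hadj : ∀ z z', ρ.Adj z z' → ∃ e ∈ HRRhs.termEdges (ρ.ruleGraph d),
        ruleVarName z ∈ e.att ∧ ruleVarName z' ∈ e.att := by
      rintro z z' ⟨a, ha, hr, hz, hz'⟩
      obtain ⟨e, he, hatt⟩ := exists_rel_of_isRel ha hr d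
      exact ⟨e, he, hatt z hz, hatt z' hz'⟩
    have h := hpath z z' fun h => hzz (h ▸ rfl)
    clear hzz
    induction h with
    | single a b h => exact .single _ _ (hadj a b h)
    | cons a c b h hc _ ih =>
      refine .cons _ _ _ (hadj a c h) ?_ ih
      rw [ruleVarName_mem_src]
      rcases c with c | c <;> simp_all

open Classical in
/-- The grammar rule of a SID rule. -/
noncomputable def toHR (ρ : SIDRule ar arP) (d : ℕ) : P × HRRhs ar arP :=
  (ρ.head, if ρ.Unproductive then .par (ρ.calls.map PredAtom.pred)
    else .op (ρ.ruleGraph d) (ρ.callList d))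

theorem toHR_of_unproductive {ρ : SIDRule ar arP} (h : ρ.Unproductive) (d : ℕ) :
    (ρ.toHR d).2 = .par (ρ.calls.map PredAtom.pred) :=
  if_pos h

theorem toHR_of_not_unproductive {ρ : SIDRule ar arP} (h : ¬ ρ.Unproductive) (d : ℕ) :
    (ρ.toHR d).2 = .op (ρ.ruleGraph d) (ρ.callList d) :=
  if_neg h

theorem nonterms_toHR (ρ : SIDRule ar arP) (d : ℕ) :
    (ρ.toHR d).2.nonterms = ρ.calls.map PredAtom.pred := by
  by_cases h : ρ.Unproductive
  · rw [toHR_of_unproductive h]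
    rfl
  · rw [toHR_of_not_unproductive h]
    refine List.ext_getElem (by simp [HRRhs.nonterms, callList]) fun i h₁ h₂ => ?_
    simp [HRRhs.nonterms, callList]

theorem isPar_toHR (ρ : SIDRule ar arP) (d : ℕ) : (ρ.toHR d).2.IsPar ↔ ρ.Unproductive := by
  by_cases h : ρ.Unproductive
  · simp [toHR_of_unproductive h, h, HRRhs.IsPar]
  · simp [toHR_of_not_unproductive h, h, HRRhs.IsPar]

theorem wellFormed_toHR {ρ : SIDRule ar arP} (heq : ρ.EqualityFree) (d : ℕ) :
    (ρ.toHR d).2.WellFormed (arP ρ.head) := by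
  by_cases h : ρ.Unproductive
  · rw [toHR_of_unproductive h]
    intro a ha
    obtain ⟨c, hc, rfl⟩ := List.mem_map.1 ha
    exact (h.2.2 c hc).arity
  · rw [toHR_of_not_unproductive h]
    exact wellFormed_ruleGraph heq d

theorem eq_of_unproductive {ρ ρ' : SIDRule ar arP} (h : ρ.Unproductive) (h' : ρ'.Unproductive)
    (hhead : ρ.head = ρ'.head)
    (hcalls : ρ.calls.map PredAtom.pred = ρ'.calls.map PredAtom.pred) : ρ = ρ' := by
  obtain ⟨B, m, ψ, cs⟩ := ρ
  obtain ⟨B', m', ψ', cs'⟩ := ρ'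
  obtain ⟨hm, hψ, hc⟩ := h
  obtain ⟨hm', hψ', hc'⟩ := h'
  obtain rfl : m = 0 := hm
  obtain rfl : m' = 0 := hm'
  obtain rfl : ψ = .emp := hψ
  obtain rfl : ψ' = .emp := hψ'
  obtain rfl : B = B' := hhead
  congr 1
  refine List.ext_getElem (by simpa using congrArg List.length hcalls) fun i h₁ h₂ => ?_
  have hpred : cs[i].pred = cs'[i].pred := by
    have := List.getElem_of_eq hcalls (i := i) (by simpa using h₁)
    simpa using this
  have e := hc _ (List.getElem_mem h₁)
  have e' := hc' _ (List.getElem_mem h₂)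
  generalize cs[i] = c at hpred e
  generalize cs'[i] = c' at hpred e'
  obtain ⟨p, a⟩ := c
  obtain ⟨p', a'⟩ := c'
  obtain rfl : p = p' := hpred
  congr 1
  exact List.ofFn_injective (e.trans e'.symm)

theorem toHR_index {ρ ρ' : SIDRule ar arP} {d d' : ℕ} (h : ¬ ρ.Unproductive)
    (hρ : ρ.RegularBody) (heq : ρ.toHR d = ρ'.toHR d') : d = d' := by
  have h2 : (ρ.toHR d).2 = (ρ'.toHR d').2 := congrArg Prod.snd heq
  have h' : ¬ ρ'.Unproductive := by
    rw [← isPar_toHR ρ' d', ← h2, isPar_toHR]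
    exact h
  rw [toHR_of_not_unproductive h, toHR_of_not_unproductive h'] at h2
  have hG : ρ.ruleGraph d = ρ'.ruleGraph d' := (HRRhs.op.inj h2).1
  have hid : ∀ (τ : SIDRule ar arP) (c : ℕ), ∀ e ∈ (τ.ruleGraph c).edges, (Nat.unpair e.id).1 = c := by
    rintro τ c _ (⟨i, r, xs, -, rfl⟩ | ⟨i, c, -, rfl⟩) <;> simp
  obtain ⟨e, he⟩ := ruleGraph_edges_nonempty hρ d
  exact (hid ρ d e he).symm.trans (hid ρ' d' e (hG ▸ he))

end SIDRule

theorem List.eq_of_map_eq_of_injOn {α β : Type*} {f : α → β} {V : Set α} (hf : Set.InjOn f V)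
    {l l' : List α} (hl : ∀ x ∈ l, x ∈ V) (hl' : ∀ x ∈ l', x ∈ V) (h : l.map f = l'.map f) :
    l = l' := by
  have hlen : l.length = l'.length := by simpa using congrArg List.length h
  refine List.ext_getElem hlen fun i h₁ h₂ => ?_
  have hi := List.getElem_of_eq h (i := i) (by simpa using h₁)
  rw [List.getElem_map, List.getElem_map] at hi
  exact hf (hl _ (List.getElem_mem h₁)) (hl' _ (List.getElem_mem h₂)) hi

namespace CGraph

theorem Iso.trans {Λ : Type u} {ar : Λ → ℕ} {G H K : CGraph ar} (h : G.Iso H) (h' : H.Iso K) :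
    G.Iso K := by
  obtain ⟨f, g, hf, hg, hv, he, hs⟩ := h
  obtain ⟨f', g', hf', hg', hv', he', hs'⟩ := h'
  have hids : H.ids = g '' G.ids := by
    simp only [ids, he, Set.image_image]
  rw [hv] at hf' hv'
  rw [hids] at hg'
  refine ⟨f' ∘ f, g' ∘ g, hf'.comp hf (Set.mapsTo_image _ _), hg'.comp hg (Set.mapsTo_image _ _),
    ?_, ?_, ?_⟩
  · rw [hv', Set.image_image]; rfl
  · rw [he', he, Set.image_image]
    simp
  · rw [hs', hs, List.map_map]

theorem Iso.length_src {Λ : Type u} {ar : Λ → ℕ} {G H : CGraph ar} (h : G.Iso H) :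
    H.src.length = G.src.length := by
  obtain ⟨f, g, -, -, -, -, hs⟩ := h
  rw [hs, List.length_map]

theorem eq_of_data_eq {Λ : Type u} {ar : Λ → ℕ} {G H : CGraph ar} (hv : G.verts = H.verts)
    (he : G.edges = H.edges) (hs : G.src = H.src) : G = H := by
  cases G
  cases H
  cases hv
  cases he
  cases hs
  rfl

/-- Every binary relation on the vertices is recorded by suitable edges with the label `none`. -/
theorem exists_rich {L : Type u} {ar : L → ℕ} (K : CGraph ar) (R : ℕ → ℕ → Prop) :
    ∃ G : CGraph (arD ar), G.proj = K ∧ ∀ a ∈ G.verts, ∀ b ∈ G.verts,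
      ((∃ e ∈ G.edges, e.lab = none ∧ e.att = [a, b]) ↔ R a b) := by
  obtain ⟨M, hM⟩ := (K.edges_finite.image HEdge.id).bddAbove
  have hlt : ∀ e ∈ K.edges, e.id ≤ M := fun e he => hM ⟨e, he, rfl⟩
  let lift : HEdge L → HEdge (Option L) := fun e => ⟨e.id, some e.lab, e.att⟩
  let pairEdge : ℕ × ℕ → HEdge (Option L) := fun x => ⟨M + 1 + Nat.pair x.1 x.2, none, [x.1, x.2]⟩
  let S : Set (ℕ × ℕ) := {x | x.1 ∈ K.verts ∧ x.2 ∈ K.verts ∧ R x.1 x.2}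
  have hS : S.Finite := (K.verts_finite.prod K.verts_finite).subset fun x hx => ⟨hx.1, hx.2.1⟩
  refine ⟨⟨K.verts, lift '' K.edges ∪ pairEdge '' S, K.src, K.verts_finite,
    (K.edges_finite.image _).union (hS.image _), ?_, ?_, ?_, K.src_mem, K.src_nodup⟩, ?_, ?_⟩
  · rintro _ (⟨e, he, rfl⟩ | ⟨x, hx, rfl⟩) _ (⟨e', he', rfl⟩ | ⟨x', hx', rfl⟩) h
    · rw [K.id_inj e he e' he' h]
    · have := hlt e he
      simp only [lift, pairEdge] at h
      omega
    · have := hlt e' he'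
      simp only [lift, pairEdge] at h
      omega
    · simp only [pairEdge, Nat.add_left_cancel_iff, Nat.pair_eq_pair] at h
      rw [Prod.ext h.1 h.2]
  · rintro _ (⟨e, he, rfl⟩ | ⟨x, hx, rfl⟩)
    · exact K.att_length e he
    · rfl
  · rintro _ (⟨e, he, rfl⟩ | ⟨x, hx, rfl⟩) y hy
    · exact K.att_mem e he y hy
    · simp only [pairEdge, List.mem_cons, List.not_mem_nil, or_false] at hy
      rcases hy with rfl | rfl
      · exact hx.1
      · exact hx.2.1
  · refine eq_of_data_eq rfl ?_ rfl
    ext ⟨k, l, a⟩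
    constructor
    · rintro (⟨⟨k', l', a'⟩, he, h⟩ | ⟨x, -, h⟩)
      · simp only [lift, HEdge.mk.injEq, Option.some.injEq] at h
        obtain ⟨rfl, rfl, rfl⟩ := h
        exact he
      · simp [pairEdge] at h
    · exact fun he => Or.inl ⟨_, he, rfl⟩
  · intro a ha b hb
    constructor
    · rintro ⟨_, ⟨e, -, rfl⟩ | ⟨x, hx, rfl⟩, hl, hatt⟩
      · simp [lift] at hl
      · simp only [pairEdge, List.cons.injEq, and_true] at hatt
        exact hatt.1 ▸ hatt.2 ▸ hx.2.2
    · intro hR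
      exact ⟨pairEdge (a, b), Or.inr ⟨(a, b), ⟨ha, hb, hR⟩, rfl⟩, rfl, rfl⟩

end CGraph

theorem PreGraph.IsCopy.length_src {L : Type u} {ar : L → ℕ} {X : Type v} {D : PreGraph L X}
    {K : CGraph ar} (h : D.IsCopy K) : K.src.length = D.src.length := by
  obtain ⟨s, g, h⟩ := h
  rw [h.src, List.length_map]

namespace SIDRule

variable {L : Type u} {ar : L → ℕ} {P : Type v} {arP : P → ℕ}

theorem RegularBody.not_unproductive {ρ : SIDRule ar arP} (h : ρ.RegularBody) :
    ¬ ρ.Unproductive := by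
  rintro ⟨hm, hψ, -⟩
  rcases h.1 with ⟨-, -, a, ha, -⟩ | ⟨⟨a, ha, -⟩ | hne, -, hcall⟩
  · simp [hψ, QFormula.atoms] at ha
  · simp [hψ, QFormula.atoms] at ha
  · obtain ⟨c, hc⟩ := List.exists_mem_of_ne_nil _ hne
    obtain ⟨j, -⟩ := hcall c hc
    exact Fin.elim0 (hm ▸ j)

end SIDRule

namespace SID

variable {L : Type u} {ar : L → ℕ} {P : Type v} {arP : P → ℕ} {Δ : SID ar arP}

theorem Regular.regularBody (hreg : Δ.Regular) :
    ∀ ρ ∈ Δ.rules, ¬ ρ.Unproductive → ρ.RegularBody := by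
  obtain ⟨Q, hQ⟩ := hreg
  intro ρ hρ hun
  rcases hQ ρ hρ with ⟨-, h, -⟩ | ⟨-, h, -⟩ | ⟨-, h⟩
  · exact (hun h).elim
  · exact (hun h).elim
  · exact h

theorem Regular.calls_ne_nil (hreg : Δ.Regular) :
    ∀ ρ ∈ Δ.rules, ρ.Unproductive → ρ.calls ≠ [] := by
  obtain ⟨Q, hQ⟩ := hreg
  intro ρ hρ hun
  rcases hQ ρ hρ with ⟨-, -, C, -, h⟩ | ⟨-, -, h, -⟩ | ⟨-, h⟩
  · intro hnil
    simp [hnil] at h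
  · exact h
  · exact (h.not_unproductive hun).elim

/-- The grammar of a SID, for a numbering `idx` of its rules. -/
noncomputable def toGrammar (Δ : SID ar arP) (heq : Δ.EqualityFree) (A : P) (idx : Δ.rules → ℕ) :
    HRGrammar ar arP where
  nonterms := insert A (⋃ ρ ∈ Δ.rules, {B | B ∈ ρ.head :: ρ.calls.map PredAtom.pred})
  rules := Set.range fun ρ : Δ.rules => ρ.1.toHR (idx ρ)
  nonterms_finite := (Δ.finite.biUnion fun _ _ => List.finite_toSet _).insert A
  rules_finite := by
    have := Δ.finite.to_subtype
    exact Set.finite_range _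
  lhs_mem := by
    rintro _ ⟨ρ, rfl⟩
    exact Or.inr (Set.mem_iUnion₂.2 ⟨ρ.1, ρ.2, List.mem_cons_self⟩)
  rhs_mem := by
    rintro _ ⟨ρ, rfl⟩ a ha
    rw [SIDRule.nonterms_toHR] at ha
    exact Or.inr (Set.mem_iUnion₂.2 ⟨ρ.1, ρ.2, List.mem_cons_of_mem _ ha⟩)
  wellFormed := by
    rintro _ ⟨ρ, rfl⟩
    exact SIDRule.wellFormed_toHR (heq ρ.1 ρ.2) _

theorem toGrammar_regular (hreg : Δ.Regular) (heq : Δ.EqualityFree) (A : P) (idx : Δ.rules → ℕ) :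
    (Δ.toGrammar heq A idx).Regular := by
  obtain ⟨Q, hQ⟩ := hreg
  refine ⟨Q ∩ (Δ.toGrammar heq A idx).nonterms, Set.inter_subset_right, ?_⟩
  intro τ hτ
  have hlhs := (Δ.toGrammar heq A idx).lhs_mem τ hτ
  have hrhs := (Δ.toGrammar heq A idx).rhs_mem τ hτ
  obtain ⟨ρ, rfl⟩ := hτ
  rw [SIDRule.nonterms_toHR] at hrhs
  rcases hQ ρ.1 ρ.2 with ⟨hB, hun, C, hC, hcalls⟩ | ⟨hB, hun, hne, hC⟩ | ⟨hB, hbody⟩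
  · refine Or.inl ⟨fun h => hB h.1, C, ⟨hC, hrhs C (by simp [hcalls])⟩, ?_⟩
    rw [SIDRule.toHR_of_unproductive hun, hcalls]
    rfl
  · refine Or.inr (Or.inl ⟨fun h => hB h.1, _, by simpa using hne, fun w hw => ⟨?_, hrhs w hw⟩,
      SIDRule.toHR_of_unproductive hun _⟩)
    obtain ⟨c, hc, rfl⟩ := List.mem_map.1 hw
    exact hC c hc
  · exact Or.inr (Or.inr ⟨⟨hB, hlhs⟩, _, _, SIDRule.toHR_of_not_unproductive
      hbody.not_unproductive _, SIDRule.regularOp_ruleGraph hbody _⟩)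

theorem toHR_injective (hreg : Δ.Regular) {idx : Δ.rules → ℕ} (hidx : Function.Injective idx) :
    Function.Injective fun ρ : Δ.rules => ρ.1.toHR (idx ρ) := by
  intro ρ ρ' h
  by_cases hun : ρ.1.Unproductive
  · have hun' : ρ'.1.Unproductive := by
      rw [← SIDRule.isPar_toHR _ (idx ρ'), ← congrArg Prod.snd h]
      exact (SIDRule.isPar_toHR _ _).2 hun
    refine Subtype.ext (SIDRule.eq_of_unproductive hun hun' (congrArg Prod.fst h) ?_)
    rw [← SIDRule.nonterms_toHR _ (idx ρ), ← SIDRule.nonterms_toHR _ (idx ρ')]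
    exact congrArg (fun x => x.2.nonterms) h
  · exact hidx (SIDRule.toHR_index hun (hreg.regularBody ρ.1 ρ.2 hun) h)

/-- The graph of a rule is a frame for the graphs of the subtrees. -/
theorem frames_ruleGraph {ρ : SIDRule ar arP} {k : ℕ} (hk : ρ.calls.length = k)
    {args : List TVar} {p : List ℕ} (h : FreshArgs args p (arP ρ.head))
    (sub : Fin k → PTree Δ.rules) (d : ℕ) :
    (ruleBase ρ args p).Frames
      (fun i : Fin k => stdGraph (sub i) (callArgs ρ args p i) ((i + 1) :: p))
      (Function.extend (inst (n := arP ρ.head) (m := ρ.m) args p) ruleVarName fun _ => 0)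
      (fun x => Nat.pair d (2 * x.2)) (ρ.ruleGraph d) (ρ.callList d) where
  s_inj := by
    rintro _ ⟨z, rfl⟩ _ ⟨z', rfl⟩ hz
    rw [h.inst_injective.extend_apply, h.inst_injective.extend_apply] at hz
    rw [ruleVarName_injective hz]
  g_inj := by
    intro x hx y hy hxy
    have h1 := addrs_ruleBase ρ args p x hx
    have h2 := addrs_ruleBase ρ args p y hy
    have h3 := (Nat.pair_eq_pair.1 hxy).2
    exact Prod.ext (h1.trans h2.symm) (by omega)
  verts := by
    simp only [SIDRule.ruleGraph, ruleBase, ← Set.range_comp]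
    congr 1
    funext z
    simp only [Function.comp, h.inst_injective.extend_apply]
  edges := by
    ext e
    rw [SIDRule.mem_termEdges_ruleGraph]
    constructor
    · rintro ⟨i, r, xs, hi, rfl⟩
      refine ⟨_, ⟨i, r, xs, hi, rfl⟩, ?_⟩
      simp only [PreEdge.real, List.map_ofFn, Function.comp_def, h.inst_injective.extend_apply]
    · rintro ⟨_, ⟨i, r, xs, hi, rfl⟩, rfl⟩
      refine ⟨i, r, xs, hi, ?_⟩
      simp only [PreEdge.real, List.map_ofFn, Function.comp_def, h.inst_injective.extend_apply]
  src := by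
    have : (ruleBase ρ args p).src = _ := (h.map_inst (m := ρ.m)).symm
    rw [this, List.map_ofFn]
    simp only [SIDRule.ruleGraph, Function.comp_def, h.inst_injective.extend_apply]
  length := by simpa [SIDRule.callList] using hk
  att i := by
    have hi : (i : ℕ) < ρ.calls.length := hk ▸ i.2
    rw [List.get_eq_getElem, stdGraph_src, callArgs_eq (List.getElem?_eq_getElem hi), List.map_ofFn]
    simp only [Fin.val_cast, SIDRule.getElem_callList ρ d i _ hi, Function.comp_def,
      h.inst_injective.extend_apply]

/-- The values of a relabelled tree are the copies of the graph described by the tree. -/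
theorem isVal_map_iff (heq : Δ.EqualityFree) {A : P} {idx : Δ.rules → ℕ}
    {γ : Δ.rules → (Δ.toGrammar heq A idx).rules} (hγ : ∀ ρ, (γ ρ).1 = ρ.1.toHR (idx ρ))
    (T : PTree Δ.rules) {n : ℕ} (hT : WellTyped T n) {args : List TVar} {p : List ℕ}
    (h : FreshArgs args p n) (K : CGraph ar) :
    (HRGrammar.IsVal (T.map γ) K ∧ K.src.length = n) ↔ (stdGraph T args p).IsCopy K := by
  induction T generalizing args p n K with
  | leaf =>
    constructor
    · rintro ⟨⟨hv, he⟩, hlen⟩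
      have hl : K.src.length = args.length := hlen.trans h.length.symm
      have hsrc : args.map (fun x => K.src.getD (args.idxOf x) 0) = K.src := by
        refine List.ext_getElem (by simp [hl]) fun i h₁ h₂ => ?_
        rw [List.getElem_map, h.nodup.idxOf_getElem, List.getD_eq_getElem _ _ h₂]
      refine ⟨fun x => K.src.getD (args.idxOf x) 0, fun _ => 0, ?_,
        by simp [stdGraph, PreEdge.addrs], ?_, ?_, hsrc.symm⟩
      · intro x hx y hy hxy
        have hx' := List.idxOf_lt_length_of_mem (l := args) hx
        have hy' := List.idxOf_lt_length_of_mem (l := args) hy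
        simp only [List.getD_eq_getElem _ _ (hl ▸ hx'), List.getD_eq_getElem _ _ (hl ▸ hy')] at hxy
        rw [K.src_nodup.getElem_inj_iff] at hxy
        exact (List.idxOf_inj hx).1 hxy
      · rw [hv]
        conv_lhs => rw [← hsrc]
        ext a
        simp [stdGraph]
      · rw [he]
        simp [stdGraph]
    · rintro ⟨s, g, hr⟩
      refine ⟨⟨?_, ?_⟩, ?_⟩
      · rw [hr.verts, hr.src]
        ext a
        simp [stdGraph]
      · rw [hr.edges]
        simp [stdGraph]
      · rw [hr.src, List.length_map]
        exact h.length
  | edge ρ k sub rest ihs ihr =>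
    have hT' := hT
    obtain ⟨hun, rfl, hk, -, hrest⟩ := hT'
    have hop : (γ ρ).1.2 = .op (ρ.1.ruleGraph (idx ρ)) (ρ.1.callList (idx ρ)) := by
      rw [hγ, SIDRule.toHR_of_not_unproductive hun]
    choose c hc hwt using fun i => hT.call i
    have hfresh : ∀ i : Fin k, FreshArgs (callArgs ρ.1 args p i) ((i + 1) :: p) (arP (c i).pred) :=
      fun i => h.call (heq ρ.1 ρ.2) (hc i)
    have hsub := fun i => stdGraph_wf_and_verts heq (sub i) (hwt i) (hfresh i)
    have hp := stdGraph_pluggable h sub fun i => (hsub i).2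
    have hbase := ruleBase_wf ρ.1 h
    have hF := frames_ruleGraph hk h sub (idx ρ)
    have hpar := PreGraph.isCopy_par (hp.wf hbase fun i => (hsub i).1)
      (stdGraph_wf_and_verts heq rest hrest (h.cons 0)).1 (stdGraph_src rest _ _).symm
      (stdGraph_mem_args heq hT h) (addrs_plug_disjoint ρ.1 sub rest args p) K
    rw [stdGraph, hpar]
    constructor
    · rintro ⟨⟨G, es, H, K₁, K₂, hop', hH, hK₁, hK₂, hK⟩, hlen⟩
      obtain ⟨rfl, rfl⟩ := HRRhs.op.inj (hop.symm.trans hop')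
      refine ⟨K₁, K₂, ?_, ?_, hK⟩
      · refine hF.isCopy_of_isSubst hp hbase (fun i => (hsub i).1) (fun i => ?_) hK₁
        refine (ihs i (hwt i) (hfresh i) _).1 ⟨hH i, ?_⟩
        obtain ⟨_, H', hiso, hsrc, -⟩ := hK₁
        rw [← (hiso i).length_src, hsrc, hF.att, List.length_map, stdGraph_src, (hfresh i).length]
      · refine (ihr hrest (h.cons 0) _).1 ⟨hK₂, ?_⟩
        obtain ⟨K₁', K₂', -, i₂, hsrc, -, -, -, -, hKs⟩ := hK
        rw [← i₂.length_src, ← hsrc, ← hKs, hlen]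
    · rintro ⟨K₁', K₂, hK₁', hK₂, hK⟩
      obtain ⟨H, K₁, hH, hK₁, hiso⟩ := hF.exists_isSubst hp hbase (fun i => (hsub i).1) hK₁'
      refine ⟨⟨_, _, H, K₁, K₂, hop, fun i => ((ihs i (hwt i) (hfresh i) _).2 (hH i)).1, hK₁,
        ((ihr hrest (h.cons 0) _).2 hK₂).1, ?_⟩, ?_⟩
      · obtain ⟨G', H', i₁, hrem⟩ := hK
        exact ⟨G', H', hiso.trans i₁, hrem⟩
      · have hlen := (hpar.2 ⟨K₁', K₂, hK₁', hK₂, hK⟩).length_src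
        exact hlen.trans h.length

theorem freshArgs_nil : FreshArgs [] [] 0 := ⟨List.nodup_nil, rfl, by simp⟩

section Canonical

variable {T : PTree Δ.rules}

theorem fv_charForm (hreg : Δ.Regular) (heq : Δ.EqualityFree) (hT : WellTyped T 0)
    (hleaf : T ≠ PTree.leaf) : (charForm T).fv = (stdGraph T [] []).verts := by
  ext x
  constructor
  · rintro ⟨a, ha, hx⟩
    exact (charFormAux_atoms heq T [] [] ha).2 x hx
  · intro hx
    obtain ⟨e, he, hxe⟩ := stdGraph_verts_covered hreg.regularBody T hleaf hT rfl x (Or.inl hx)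
    obtain ⟨xs, hatt, hmem⟩ := (describes_charFormAux T [] []).rel_mem e he
    rw [hatt, List.mem_ofFn] at hxe
    exact ⟨_, hmem, hxe⟩

theorem attVerts_stdGraph (hreg : Δ.Regular) (heq : Δ.EqualityFree) (hT : WellTyped T 0)
    (hleaf : T ≠ PTree.leaf) :
    PreEdge.attVerts (stdGraph T [] []).edges = (stdGraph T [] []).verts := by
  ext x
  constructor
  · rintro ⟨e, he, hx⟩
    exact (stdGraph_wf_and_verts heq T hT freshArgs_nil).1.att_mem e he x hx
  · exact fun hx => stdGraph_verts_covered hreg.regularBody T hleaf hT rfl x (Or.inl hx)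

/-- Copies of the graph described by the tree are models of a satisfiable characteristic formula. -/
theorem models_of_realizes (hreg : Δ.Regular) (heq : Δ.EqualityFree) (hT : WellTyped T 0)
    (hleaf : T ≠ PTree.leaf) (hsat : (charForm T).Satisfiable) {s g : TVar → ℕ} {K : CGraph ar}
    (hK : (stdGraph T [] []).Realizes s g K) : QFormula.Models K s (charForm T) := by
  have hdesc := describes_charFormAux T [] []
  obtain ⟨G₀, s₀, -, hsimple, hG₀⟩ := hsat
  obtain ⟨hpure, g₀, hg₀, -, he₀⟩ := (hdesc.sat_iff s₀ G₀).1 hG₀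
  have hwf := (stdGraph_wf_and_verts heq T hT freshArgs_nil).1
  refine ⟨?_, ?_, (hdesc.sat_iff s K).2 ⟨?_, g, hK.g_inj, ?_, hK.edges⟩⟩
  · rw [hK.src, stdGraph_src]
    rfl
  · intro e he e' he' hlab hatt
    rw [hK.edges] at he he'
    obtain ⟨f, hf, rfl⟩ := he
    obtain ⟨f', hf', rfl⟩ := he'
    have hatt' : f.att = f'.att :=
      List.eq_of_map_eq_of_injOn hK.s_inj (hwf.att_mem f hf) (hwf.att_mem f' hf') hatt
    have heq₀ := hsimple (f.real s₀ g₀) (he₀ ▸ ⟨f, hf, rfl⟩) (f'.real s₀ g₀)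
      (he₀ ▸ ⟨f', hf', rfl⟩) hlab (congrArg (List.map s₀) hatt')
    have haddr := hg₀ (PreEdge.mem_addrs hf) (PreEdge.mem_addrs hf') (congrArg HEdge.id heq₀)
    rw [hwf.addr_inj hf hf' haddr]
  · intro a ha
    obtain ⟨hne, hvars⟩ := charFormAux_atoms heq T [] [] ha
    have ha₀ := hpure a ha
    cases a with
    | eq x y => exact (hne x y rfl).elim
    | neq x y =>
      intro hxy
      exact ha₀ (congrArg s₀ (hK.s_inj (hvars x (Or.inl rfl)) (hvars y (Or.inr rfl)) hxy))
    | rel r xs => trivial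
  · rw [attVerts_stdGraph hreg heq hT hleaf, hK.verts]

theorem canonical_iff_injOn (hreg : Δ.Regular) (heq : Δ.EqualityFree) (hT : WellTyped T 0)
    (hleaf : T ≠ PTree.leaf) (hsat : (charForm T).Satisfiable) (s : TVar → ℕ) :
    QFormula.Canonical s (charForm T) ↔ Set.InjOn s (stdGraph T [] []).verts := by
  rw [← fv_charForm hreg heq hT hleaf]
  constructor
  · intro hs x hx y hy hxy
    obtain ⟨K, hK⟩ := (stdGraph_wf_and_verts heq T hT freshArgs_nil).1.exists_realizes
      (s := Encodable.encode) (g := Encodable.encode) Encodable.encode_injective.injOn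
      Encodable.encode_injective.injOn
    exact Encodable.encode_injective
      (hs x hx y hy hxy K _ (models_of_realizes hreg heq hT hleaf hsat hK))
  · intro hs x hx y hy hxy
    obtain rfl := hs hx hy hxy
    exact fun _ _ _ => rfl

theorem canonical_models_iff_realizes (hreg : Δ.Regular) (heq : Δ.EqualityFree)
    (hT : WellTyped T 0) (hleaf : T ≠ PTree.leaf) (hsat : (charForm T).Satisfiable)
    (s : TVar → ℕ) (K : CGraph ar) :
    (QFormula.Canonical s (charForm T) ∧ QFormula.Models K s (charForm T)) ↔
      ∃ g, (stdGraph T [] []).Realizes s g K := by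
  rw [canonical_iff_injOn hreg heq hT hleaf hsat]
  constructor
  · rintro ⟨hs, hsrc, -, hmod⟩
    obtain ⟨-, g, hg, hv, he⟩ := ((describes_charFormAux T [] []).sat_iff s K).1 hmod
    refine ⟨g, hs, hg, ?_, he, ?_⟩
    · rw [hv, attVerts_stdGraph hreg heq hT hleaf]
    · rw [hsrc, stdGraph_src]
      rfl
  · rintro ⟨g, hK⟩
    exact ⟨hK.s_inj, models_of_realizes hreg heq hT hleaf hsat hK⟩

end Canonical

/-- The canonical models are the copies of the graphs described by the parse trees. -/
theorem mem_canonicalModels_iff (hreg : Δ.Regular) (heq : Δ.EqualityFree) {A : P} (hA : arP A = 0)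
    (hsat : Δ.AllSatisfiable A) (K : CGraph ar) :
    K ∈ Δ.canonicalModels A ↔ ∃ T ∈ Δ.parseTrees A, (stdGraph T [] []).IsCopy K := by
  constructor
  · rintro ⟨G, ⟨T, hT, s, hs, hmod, -⟩, rfl⟩
    obtain ⟨hwt, hleaf⟩ := wellTyped_of_mem_parseTrees hreg.calls_ne_nil hT
    rw [hA] at hwt
    exact ⟨T, hT, s,
      (canonical_models_iff_realizes hreg heq hwt hleaf (hsat T hT) s _).1 ⟨hs, hmod⟩⟩
  · rintro ⟨T, hT, s, hr⟩
    obtain ⟨hwt, hleaf⟩ := wellTyped_of_mem_parseTrees hreg.calls_ne_nil hT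
    rw [hA] at hwt
    obtain ⟨hs, hmod⟩ := (canonical_models_iff_realizes hreg heq hwt hleaf (hsat T hT) s K).2 hr
    obtain ⟨G, rfl, hG⟩ := K.exists_rich
      fun a b => ∃ x y, s x = a ∧ s y = b ∧ Atom.neq x y ∈ (charForm T).atoms
    exact ⟨G, ⟨T, hT, s, hs, hmod, hG⟩, rfl⟩

end SID

theorem mainTheorem2 {L : Type u} (ar : L → ℕ) {P : Type v} (arP : P → ℕ)
    (Δ : SID ar arP) (A : P) (hA : arP A = 0)
    (hreg : Δ.Regular) (heq : Δ.EqualityFree) (hsat : Δ.AllSatisfiable A) :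
    ∃ (N : Type v) (arN : N → ℕ) (Γ : HRGrammar ar arN) (w : N) (γ : Δ.rules ≃ Γ.rules),
      Γ.Regular ∧ w ∈ Γ.nonterms ∧ arN w = 0 ∧
      (∀ T : PTree Δ.rules, T ∈ Δ.parseTrees A ↔ T.map γ ∈ Γ.parseTrees w) ∧
      Δ.canonicalModels A = Γ.language w := by
  have := Δ.finite.to_subtype
  obtain ⟨idx, hidx⟩ := Countable.exists_injective_nat Δ.rules
  let Γ := Δ.toGrammar heq A idx
  let γ : Δ.rules ≃ Γ.rules := Equiv.ofInjective _ (SID.toHR_injective hreg hidx)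
  have hγ : ∀ ρ, (γ ρ).1 = ρ.1.toHR (idx ρ) := fun ρ => rfl
  have hparse : ∀ T : PTree Δ.rules, T ∈ Δ.parseTrees A ↔ T.map γ ∈ Γ.parseTrees A := by
    intro T
    rw [HRGrammar.parseTrees, ← mem_parseTrees_iff_map γ, SID.parseTrees]
    have h₁ : (fun ρ : Γ.rules => ρ.1.1) ∘ γ = fun ρ : Δ.rules => ρ.1.head := rfl
    have h₂ : (fun ρ : Γ.rules => ρ.1.2.nonterms) ∘ γ =
        fun ρ : Δ.rules => ρ.1.calls.map PredAtom.pred :=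
      funext fun ρ => SIDRule.nonterms_toHR ρ.1 (idx ρ)
    have h₃ : (fun ρ : Γ.rules => ρ.1.2.IsPar) ∘ γ = fun ρ : Δ.rules => ρ.1.Unproductive :=
      funext fun ρ => propext (SIDRule.isPar_toHR ρ.1 (idx ρ))
    rw [h₁, h₂, h₃]
  refine ⟨P, arP, Γ, A, γ, SID.toGrammar_regular hreg heq A idx, Set.mem_insert _ _, hA, hparse, ?_⟩
  have hval : ∀ T ∈ Δ.parseTrees A, ∀ K : CGraph ar,
      (HRGrammar.IsVal (T.map γ) K ∧ K.src.length = 0) ↔ (SID.stdGraph T [] []).IsCopy K := by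
    intro T hT K
    have hwt := (SID.wellTyped_of_mem_parseTrees hreg.calls_ne_nil hT).1
    rw [hA] at hwt
    exact SID.isVal_map_iff heq hγ T hwt SID.freshArgs_nil K
  ext K
  rw [SID.mem_canonicalModels_iff hreg heq hA hsat]
  constructor
  · rintro ⟨T, hT, hK⟩
    obtain ⟨hv, hlen⟩ := (hval T hT K).2 hK
    exact ⟨hlen.trans hA.symm, T.map γ, (hparse T).1 hT, hv⟩
  · rintro ⟨hlen, T', hT', hv⟩
    have hmap : (T'.map γ.symm).map γ = T' := by
      rw [PTree.map_map, Equiv.self_comp_symm, PTree.map_id]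
    have hT : T'.map γ.symm ∈ Δ.parseTrees A := by
      rw [hparse, hmap]
      exact hT'
    refine ⟨_, hT, (hval _ hT K).1 ⟨?_, hlen.trans hA⟩⟩
    rw [hmap]
    exact hv
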